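/- Define classes $\mathcal C_n$ of groups ($n\ge 0$) as follows. The class $\mathcal C_0$ consists of the free products $A\ast B$ of non-trivial finitely presented groups $A,B$, at least one of which has at least $3$ elements. For $n\ge 1$, a group lies in $\mathcal C_n$ if and only if it is isomorphic to the fundamental group of a finite, acylindrical graph of finitely presented groups in which all edge groups are cyclic and at least one vertex group lies in $\mathcal C_{n-1}$. Here a graph of groups is called acylindrical if there is an integer $k\ge 0$ such that, in the action of its fundamental group on the associated Bass–Serre tree, the (pointwise) stabilizer of every geodesic edge-path of length greater than $k$ is trivial. Let $\mathcal C=\bigcup_{n\ge 0}\mathcal C_n$. Theorem. Let $\Gamma$ be a group in $\mathcal C$, let $N$ be a non-trivial normal subgroup of $\Gamma$, and let $G$ be a finitely generated subgroup of $\Gamma$ with $N\subseteq G$. Then $G$ has finite index in $\Gamma$. -/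

import Mathlib

universe u

open scoped Monoid.Coprod

/-- The simple graph underlying an oriented multigraph with vertex set `V`, edge set `E` and
endpoint maps `src`, `tgt`: distinct vertices are adjacent when some edge joins them. -/
def underlyingGraph {V E : Type*} (src tgt : E → V) : SimpleGraph V :=
  SimpleGraph.fromRel fun a b => ∃ e, src e = a ∧ tgt e = b

/-- An oriented multigraph is a tree if it has no loops, no multiple edges, and its underlying
simple graph is a tree. -/
structure IsMultigraphTree {V E : Type*} (src tgt : E → V) : Prop where
  no_loops : ∀ e, src e ≠ tgt e
  no_multiple_edges : Function.Injective fun e => s(src e, tgt e)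
  isTree : (underlyingGraph src tgt).IsTree

/-- A graph of groups: a connected non-empty graph (loops and multiple edges are allowed; `E` has
one element for each geometric edge, with a chosen orientation from `src e` to `tgt e`), a group
for each vertex and each edge, and injective homomorphisms from each edge group to the vertex
groups at the two ends of the edge. -/
structure GraphOfGroups : Type (u + 1) where
  V : Type u
  E : Type u
  src : E → V
  tgt : E → V
  connected : (underlyingGraph src tgt).Connected
  vertexGroup : V → Type u
  edgeGroup : E → Type u
  [instVertexGroup : ∀ v, Group (vertexGroup v)]
  [instEdgeGroup : ∀ e, Group (edgeGroup e)]
  srcHom : ∀ e, edgeGroup e →* vertexGroup (src e)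
  tgtHom : ∀ e, edgeGroup e →* vertexGroup (tgt e)
  srcHom_injective : ∀ e, Function.Injective (srcHom e)
  tgtHom_injective : ∀ e, Function.Injective (tgtHom e)

namespace GraphOfGroups

attribute [instance] GraphOfGroups.instVertexGroup GraphOfGroups.instEdgeGroup

variable (𝒢 : GraphOfGroups.{u})

/-- A set `T` of edges is (the edge set of) a maximal tree if the subgraph consisting of all
vertices and the edges in `T` is a tree. -/
def IsMaximalTree (T : Set 𝒢.E) : Prop :=
  IsMultigraphTree (fun e : T => 𝒢.src e) (fun e : T => 𝒢.tgt e)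

/-- The free product of all vertex groups and the free group on the edges (stable letters). -/
abbrev PathGroup : Type u := Monoid.CoprodI 𝒢.vertexGroup ∗ FreeGroup 𝒢.E

/-- The element of `PathGroup` given by an element of a vertex group. -/
def preVertex (v : 𝒢.V) : 𝒢.vertexGroup v →* 𝒢.PathGroup :=
  Monoid.Coprod.inl.comp Monoid.CoprodI.of

/-- The stable letter of an edge. -/
def preLetter (e : 𝒢.E) : 𝒢.PathGroup := Monoid.Coprod.inr (FreeGroup.of e)

/-- The relators of the fundamental group: `t_e · tgtHom e a · t_e⁻¹ = srcHom e a` for all edges `e`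
and all `a` in the edge group, and `t_e = 1` for the edges `e` in the maximal tree. -/
def relators (T : Set 𝒢.E) : Set 𝒢.PathGroup :=
  {r | ∃ (e : 𝒢.E) (a : 𝒢.edgeGroup e),
      r = 𝒢.preLetter e * 𝒢.preVertex _ (𝒢.tgtHom e a) * (𝒢.preLetter e)⁻¹ *
        (𝒢.preVertex _ (𝒢.srcHom e a))⁻¹} ∪
    𝒢.preLetter '' T

/-- The fundamental group of the graph of groups relative to the maximal tree `T`. -/
abbrev FundamentalGroup (T : Set 𝒢.E) : Type u :=
  𝒢.PathGroup ⧸ Subgroup.normalClosure (𝒢.relators T)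

/-- The canonical map from a vertex group to the fundamental group. -/
def vertexHom (T : Set 𝒢.E) (v : 𝒢.V) : 𝒢.vertexGroup v →* 𝒢.FundamentalGroup T :=
  (QuotientGroup.mk' _).comp (𝒢.preVertex v)

/-- The image of the stable letter of an edge in the fundamental group. -/
def letter (T : Set 𝒢.E) (e : 𝒢.E) : 𝒢.FundamentalGroup T :=
  QuotientGroup.mk' _ (𝒢.preLetter e)

/-- The vertices of the Bass–Serre tree: the cosets in the fundamental group of (the images of) the
vertex groups. The fundamental group acts on them by left translation. -/
abbrev BassSerreVertex (T : Set 𝒢.E) : Type u :=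
  Σ v : 𝒢.V, 𝒢.FundamentalGroup T ⧸ (𝒢.vertexHom T v).range

/-- The Bass–Serre tree: the edges are the cosets `g G_e`, where `G_e` is embedded through `srcHom`,
and `g G_e` joins the vertices `g G_{src e}` and `g t_e G_{tgt e}` (which do not depend on the
representative `g`). -/
def bassSerreTree (T : Set 𝒢.E) : SimpleGraph (𝒢.BassSerreVertex T) :=
  SimpleGraph.fromRel fun x y => ∃ (e : 𝒢.E) (g : 𝒢.FundamentalGroup T),
    x = ⟨𝒢.src e, (g : 𝒢.FundamentalGroup T ⧸ _)⟩ ∧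
    y = ⟨𝒢.tgt e, ((g * 𝒢.letter T e : 𝒢.FundamentalGroup T) : 𝒢.FundamentalGroup T ⧸ _)⟩

/-- `k`-acylindricity: in the action of the fundamental group on the Bass–Serre tree, the
(pointwise) stabilizer of every geodesic edge-path of length greater than `k` is trivial.
In a tree the geodesics are the paths without repeated vertices. -/
def IsAcylindricalWith (T : Set 𝒢.E) (k : ℕ) : Prop :=
  ∀ (x y : 𝒢.BassSerreVertex T) (p : (𝒢.bassSerreTree T).Walk x y), p.IsPath → k < p.length →
    ∀ g : 𝒢.FundamentalGroup T, (∀ z ∈ p.support, g • z = z) → g = 1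

/-- A graph of groups is acylindrical if it is `k`-acylindrical for some `k`. -/
def IsAcylindrical (T : Set 𝒢.E) : Prop := ∃ k, 𝒢.IsAcylindricalWith T k

end GraphOfGroups

/-- The class `𝒞ₙ`. Level `0`: free products `A ∗ B` of non-trivial finitely presented groups, at
least one of which has at least three elements. Level `n + 1`: fundamental groups of finite
acylindrical graphs of finitely presented groups with cyclic edge groups and with at least one
vertex group of level `n`. -/
def ClassCLevel : ℕ → ∀ (Γ : Type u) [Group Γ], Prop
  | 0, Γ, _ => ∃ (A B : Type u) (_ : Group A) (_ : Group B),
      Nontrivial A ∧ Nontrivial B ∧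
      Group.IsFinitelyPresented A ∧ Group.IsFinitelyPresented B ∧
      (3 ≤ ENat.card A ∨ 3 ≤ ENat.card B) ∧
      Nonempty (Γ ≃* A ∗ B)
  | n + 1, Γ, _ => ∃ (𝒢 : GraphOfGroups.{u}) (T : Set 𝒢.E),
      Finite 𝒢.V ∧ Finite 𝒢.E ∧
      𝒢.IsMaximalTree T ∧
      (∀ v, Group.IsFinitelyPresented (𝒢.vertexGroup v)) ∧
      (∀ e, IsCyclic (𝒢.edgeGroup e)) ∧
      𝒢.IsAcylindrical T ∧
      (∃ v, ClassCLevel n (𝒢.vertexGroup v)) ∧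
      Nonempty (Γ ≃* 𝒢.FundamentalGroup T)

/-- The class `𝒞`, the union of the classes `𝒞ₙ`. -/
def InClassC (Γ : Type u) [Group Γ] : Prop := ∃ n, ClassCLevel n Γ

/-!
The theorem is proved for a larger class of subgroups, so that it can be shown by induction on the
level of the group. Call a subgroup *wide* if it contains a non-trivial normal subgroup, or if it
has finitely many double cosets with some cyclic subgroup (`Subgroup.IsWide`). Finitely generated
wide subgroups of groups in the class have finite index (`ClassCLevel.wideImpliesFiniteIndex`).

Let `Γ` act acylindrically on a tree with cyclic edge stabilizers, let `V` be the stabilizer of a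
vertex `v`, and let `G` be finitely generated and wide. The first step is that `G` has finitely many
orbits on the orbit of some edge `e` at `v` (`TreeAction.exists_edge_finiteOrbitsOn_of_isWide`).
If `G` contains a normal subgroup `N ≠ 1`, then `N` contains a hyperbolic element
(`TreeAction.Acylindrical.exists_shift_mem`). All translates of its axis are axes of elements of
`N`, so they lie in the smallest `G`-invariant subtree, on which `G` is cofinite. If instead
`Γ = G F ⟨c⟩` with `F` finite and `c` hyperbolic, the tree is covered up to finitely many
`G`-orbits by `G`-translates of finitely many rays; if some ray escaped to an end in an essential
way, acylindricity would show that all `Γ`-translates of the axis of `c` share this end, which is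
incompatible with the action of `V` (`TreeAction.finiteOrbitsOn_orbit_of_cyclic`).

Since edge stabilizers are cyclic, `G ∩ V` is finitely generated (`TreeAction.fg_inf_stabilizer`),
and by the first step it has finitely many double cosets in `V` with the cyclic stabilizer of `e`.
Hence it is wide in `V`, and has finite index in `V` by induction
(`TreeAction.exists_finite_of_vertex`). This applies to all conjugates of `G` as well, and together
with the finiteness of the number of `G`-orbits on the orbit of `e` it gives finite index in `Γ`
(`FiniteOrbitsOn.finiteIndex`). At level zero the free product acts on a tree with trivial edge
stabilizers, and the first step suffices.

Trees are encoded by the half-spaces bounded by their edges (`TreeAction`), which makes geodesics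
superfluous. That the Bass–Serre graph is a tree is derived from a cocycle modulo two
(`GraphOfGroups.nonempty_cosetTreeData`), and vertex groups embed into the fundamental group because
they act freely and compatibly on a common set (`GraphOfGroups.vertexHom_injective`).
-/

/-! ### Trees encoded by half-spaces -/

/-- An action of `Γ` without inversions on a tree with vertex set `X` and (oriented) edge set `E`.
The tree is encoded by its half-spaces: removing the edge `e` leaves two components, and `pos e` is
the one containing the end point `tgt e`. The axioms say that `e` is the only edge joining `pos e`
to its complement, and that the graph is connected; together they characterise trees. -/
structure TreeAction (Γ X E : Type*) [Group Γ] [MulAction Γ X] [MulAction Γ E] where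
  src : E → X
  tgt : E → X
  src_smul : ∀ (g : Γ) (e : E), src (g • e) = g • src e
  tgt_smul : ∀ (g : Γ) (e : E), tgt (g • e) = g • tgt e
  pos : E → Set X
  smul_mem_pos : ∀ (g : Γ) (e : E) (x : X), g • x ∈ pos (g • e) ↔ x ∈ pos e
  src_notMem : ∀ e, src e ∉ pos e
  tgt_mem : ∀ e, tgt e ∈ pos e
  pos_iff : ∀ e e', e' ≠ e → (src e' ∈ pos e ↔ tgt e' ∈ pos e)
  connected : ∀ P : X → Prop, (∀ e, P (src e) ↔ P (tgt e)) → ∀ x y, P x → P y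

namespace TreeAction

section Basic

variable {Γ X E : Type*} [Group Γ] [MulAction Γ X] [MulAction Γ E] (t : TreeAction Γ X E)

/-- The two half-spaces bounded by `e`: `side e true` contains `tgt e`, and `side e false` contains
`src e`. -/
def side (e : E) (b : Bool) : Set X := {x | x ∈ t.pos e ↔ b = true}

/-- The end point of `e` lying in `side e b`. -/
def endpt (e : E) (b : Bool) : X := bif b then t.tgt e else t.src e

theorem mem_side_not {e : E} {b : Bool} {x : X} : x ∈ t.side e (!b) ↔ x ∉ t.side e b := by
  cases b <;> simp [side]

theorem side_not (e : E) (b : Bool) : t.side e (!b) = (t.side e b)ᶜ := by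
  ext x; exact t.mem_side_not

theorem endpt_mem (e : E) (b : Bool) : t.endpt e b ∈ t.side e b := by
  cases b <;> simp [side, endpt, t.src_notMem, t.tgt_mem]

theorem endpt_not_notMem (e : E) (b : Bool) : t.endpt e (!b) ∉ t.side e b := by
  rw [← t.mem_side_not]; exact t.endpt_mem _ _

theorem endpt_smul (g : Γ) (e : E) (b : Bool) : t.endpt (g • e) b = g • t.endpt e b := by
  cases b <;> simp [endpt, t.src_smul, t.tgt_smul]

theorem endpt_mem_side_iff {e e' : E} (h : e' ≠ e) (b b₁ b₂ : Bool) :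
    t.endpt e' b₁ ∈ t.side e b ↔ t.endpt e' b₂ ∈ t.side e b := by
  have := t.pos_iff e e' h
  cases b₁ <;> cases b₂ <;> simp [side, endpt, this]

theorem smul_mem_side (g : Γ) {e : E} {b : Bool} {x : X} :
    g • x ∈ t.side (g • e) b ↔ x ∈ t.side e b := by
  simp [side, t.smul_mem_pos]

theorem mem_side_smul (g : Γ) {e : E} {b : Bool} {x : X} :
    x ∈ t.side (g • e) b ↔ g⁻¹ • x ∈ t.side e b := by
  rw [← t.smul_mem_side g (x := g⁻¹ • x), smul_inv_smul]

theorem side_smul_mono (g : Γ) {e e' : E} {b b' : Bool} (h : t.side e b ⊆ t.side e' b') :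
    t.side (g • e) b ⊆ t.side (g • e') b' := by
  intro x hx
  rw [mem_side_smul] at hx ⊢
  exact h hx

/-- A half-space determines its bounding edge. -/
theorem side_injective {e e' : E} {b b' : Bool} (h : t.side e b = t.side e' b') : e = e' := by
  by_contra hne
  have h1 := (t.endpt_mem_side_iff hne b' b (!b)).1 (h ▸ t.endpt_mem e b)
  exact t.endpt_not_notMem e b (h ▸ h1)

theorem induction_endpt (P : X → Prop) (h : ∀ e b, P (t.endpt e b) → P (t.endpt e (!b)))
    {x : X} (hx : P x) (y : X) : P y :=
  t.connected P (fun e => ⟨h e false, h e true⟩) x y hx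

/-- If `e` lies in a half-space of `e'` and conversely, these two half-spaces cover the tree. -/
theorem side_union {e e' : E} (hne : e ≠ e') {b b' c c' : Bool}
    (h : t.endpt e c ∈ t.side e' b') (h' : t.endpt e' c' ∈ t.side e b) (x : X) :
    x ∈ t.side e b ∨ x ∈ t.side e' b' := by
  refine t.induction_endpt (fun x => x ∈ t.side e b ∨ x ∈ t.side e' b') ?_ (.inr h) x
  intro f a hf
  by_cases h1 : f = e
  · subst h1; exact .inr ((t.endpt_mem_side_iff hne _ _ _).1 h)
  by_cases h2 : f = e'
  · subst h2; exact .inl ((t.endpt_mem_side_iff hne.symm _ _ _).1 h')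
  rwa [t.endpt_mem_side_iff h1 b (!a) a, t.endpt_mem_side_iff h2 b' (!a) a]

/-- Two half-spaces missing a common vertex are nested or disjoint. -/
theorem side_trichotomy {e e' : E} {b b' : Bool} {z : X} (hz : z ∉ t.side e b)
    (hz' : z ∉ t.side e' b') :
    Disjoint (t.side e b) (t.side e' b') ∨ t.side e b ⊆ t.side e' b' ∨
      t.side e' b' ⊆ t.side e b := by
  by_cases hne : e = e'
  · subst hne
    cases b <;> cases b' <;> simp_all [side]
  by_cases h1 : t.endpt e true ∈ t.side e' b' <;> by_cases h2 : t.endpt e' true ∈ t.side e b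
  · rcases t.side_union hne h1 h2 z with h | h <;> contradiction
  · rw [← t.mem_side_not] at h2
    right; left
    intro x hx
    exact (t.side_union hne h1 h2 x).resolve_left (fun h => t.mem_side_not.1 h hx)
  · rw [← t.mem_side_not] at h1
    right; right
    intro x hx
    exact (t.side_union hne h1 h2 x).resolve_right (fun h => t.mem_side_not.1 h hx)
  · rw [← t.mem_side_not] at h1 h2
    left
    rw [Set.disjoint_left]
    intro x hx hx'
    rcases t.side_union hne h1 h2 x with h | h
    · exact t.mem_side_not.1 h hx
    · exact t.mem_side_not.1 h hx'

/-- If the edge `e` lies in a half-space `S` of another edge, and the complement of `S` contains a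
vertex outside a half-space `H` of `e`, then `H ⊆ S`. -/
theorem side_subset_of_endpt_mem {e a : E} (hne : e ≠ a) {b b' c : Bool} {p : X}
    (h : t.endpt e c ∈ t.side a b') (hp : p ∉ t.side a b') (hp' : p ∉ t.side e b) :
    t.side e b ⊆ t.side a b' := by
  have hz : t.endpt e (!b) ∈ t.side a b' := (t.endpt_mem_side_iff hne _ _ _).1 h
  by_cases h2 : t.endpt a true ∈ t.side e b
  · rcases t.side_union hne h h2 p with h | h <;> contradiction
  · rw [← t.mem_side_not] at h2
    intro x hx
    exact (t.side_union hne h h2 x).resolve_left (fun h => t.mem_side_not.1 h hx)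

/-- The set of edges separating two vertices. -/
def sep (x y : X) : Set E := {e | ¬ (x ∈ t.pos e ↔ y ∈ t.pos e)}

theorem mem_sep_of_side {x y : X} {e : E} {b : Bool} (hx : x ∉ t.side e b) (hy : y ∈ t.side e b) :
    e ∈ t.sep x y := by
  cases b <;> simp_all [side, sep]

theorem exists_side_of_mem_sep {x y : X} {e : E} (h : e ∈ t.sep x y) :
    ∃ b, x ∉ t.side e b ∧ y ∈ t.side e b := by
  by_cases hx : x ∈ t.pos e
  · exact ⟨false, by simp_all [side, sep]⟩
  · exact ⟨true, by simp_all [side, sep]⟩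

theorem sep_comm (x y : X) : t.sep x y = t.sep y x := by
  ext e; simp only [sep, Set.mem_ofPred_eq]; tauto

theorem sep_self (x : X) : t.sep x x = ∅ := by
  ext e; simp [sep]

theorem sep_subset (x y z : X) : t.sep x z ⊆ t.sep x y ∪ t.sep y z := by
  intro e; simp only [sep, Set.mem_ofPred_eq, Set.mem_union]; tauto

theorem smul_mem_sep (g : Γ) {x y : X} {e : E} : g • e ∈ t.sep (g • x) (g • y) ↔ e ∈ t.sep x y := by
  simp [sep, t.smul_mem_pos]

theorem sep_endpt_subset (e : E) (b b' : Bool) : t.sep (t.endpt e b) (t.endpt e b') ⊆ {e} := by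
  intro f hf
  by_contra hne
  have := t.pos_iff f e (Ne.symm hne)
  cases b <;> cases b' <;> simp_all [sep, endpt]

theorem sep_finite (x y : X) : (t.sep x y).Finite := by
  refine t.induction_endpt (fun y => (t.sep x y).Finite) ?_ (x := x)
    (by simp [sep_self]) y
  intro e b h
  exact (h.union ((Set.finite_singleton e).subset (t.sep_endpt_subset e b (!b)))).subset
    (t.sep_subset _ _ _)

/-- The first edge of the geodesic from `x` to `y`. -/
theorem exists_endpt_eq_of_ne {x y : X} (h : x ≠ y) :
    ∃ e b, t.endpt e (!b) = x ∧ y ∈ t.side e b := by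
  have key : ∀ z, z = x ∨ ∃ e b, t.endpt e (!b) = x ∧ z ∈ t.side e b := by
    intro z
    refine t.induction_endpt (fun z => z = x ∨ ∃ e b, t.endpt e (!b) = x ∧ z ∈ t.side e b) ?_
      (.inl rfl) z
    rintro f a (h | ⟨e, b, hx, hz⟩)
    · exact .inr ⟨f, !a, by simpa using h, t.endpt_mem _ _⟩
    · by_cases hf : f = e
      · subst hf
        by_cases hab : a = b
        · subst hab; exact .inl hx
        · have : a = !b := by cases a <;> cases b <;> simp_all
          subst this
          exact absurd hz (t.endpt_not_notMem _ _)
      · exact .inr ⟨e, b, hx, (t.endpt_mem_side_iff hf _ _ _).1 hz⟩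
  exact (key y).resolve_left h.symm

/-- `g` is hyperbolic and translates the edge `e` into its half-space `side e b`. -/
def Shift (g : Γ) (e : E) (b : Bool) : Prop := t.side (g • e) b ⊂ t.side e b

variable {t}

theorem Shift.inv {g : Γ} {e : E} {b : Bool} (h : t.Shift g e b) : t.Shift g⁻¹ e (!b) := by
  have h1 := h.1
  refine ⟨?_, fun h3 => h.2 ?_⟩
  · have := t.side_smul_mono g⁻¹ h1
    rw [inv_smul_smul] at this
    rwa [side_not, side_not, Set.compl_subset_compl]
  · rw [side_not, side_not, Set.compl_subset_compl] at h3
    have := t.side_smul_mono g h3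
    rwa [smul_inv_smul] at this

theorem Shift.conj {g : Γ} {e : E} {b : Bool} (h : t.Shift g e b) (γ : Γ) :
    t.Shift (γ * g * γ⁻¹) (γ • e) b := by
  have h0 : (γ * g * γ⁻¹) • γ • e = γ • g • e := by simp [mul_smul]
  refine ⟨?_, fun h3 => h.2 ?_⟩
  · rw [h0]; exact t.side_smul_mono γ h.1
  · rw [h0] at h3
    have := t.side_smul_mono γ⁻¹ h3
    simpa using this

theorem Shift.translate {g : Γ} {e : E} {b : Bool} (h : t.Shift g e b) (n : ℕ) :
    t.Shift g (g ^ n • e) b := by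
  have := h.conj (g ^ n)
  rwa [show g ^ n * g * (g ^ n)⁻¹ = g by group] at this

theorem Shift.anti {g : Γ} {e : E} {b : Bool} (h : t.Shift g e b) {m n : ℕ} (hmn : m ≤ n) :
    t.side (g ^ n • e) b ⊆ t.side (g ^ m • e) b := by
  induction n, hmn using Nat.le_induction with
  | base => exact subset_rfl
  | succ n _ ih =>
    refine (t.side_smul_mono (g ^ n) h.1).trans ?_ |> fun h' => by rwa [pow_succ, mul_smul]
    exact ih

theorem Shift.pow_smul_injective {g : Γ} {e : E} {b : Bool} (h : t.Shift g e b) :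
    Function.Injective fun n : ℕ => g ^ n • e := by
  have key : ∀ m n : ℕ, m < n → g ^ m • e ≠ g ^ n • e := by
    intro m n hmn heq
    refine (h.translate m).2 ?_
    have := h.anti (Nat.succ_le_of_lt hmn)
    rw [← heq, pow_succ', mul_smul] at this
    exact this
  intro m n hmn
  rcases lt_trichotomy m n with h1 | h1 | h1
  · exact absurd hmn (key _ _ h1)
  · exact h1
  · exact absurd hmn.symm (key _ _ h1)

theorem Shift.pow_smul_mem_mono {g : Γ} {e : E} {b : Bool} (h : t.Shift g e b) {x : X} {m n : ℕ}
    (hmn : m ≤ n) (hx : g ^ m • x ∈ t.side e b) : g ^ n • x ∈ t.side e b := by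
  induction n, hmn using Nat.le_induction with
  | base => exact hx
  | succ n _ ih =>
    rw [pow_succ', mul_smul]
    exact h.1 ((t.smul_mem_side g).2 ih)

/-- The forward orbit of any vertex under a hyperbolic element enters the attracting half-space:
otherwise infinitely many edges would separate it from a vertex of that half-space. -/
theorem Shift.eventually_mem {g : Γ} {e : E} {b : Bool} (h : t.Shift g e b) (x : X) :
    ∃ n : ℕ, ∀ m ≥ n, g ^ m • x ∈ t.side e b := by
  by_contra hcon
  push Not at hcon
  have hx : ∀ n : ℕ, g ^ n • x ∉ t.side e b := by
    intro n hn
    obtain ⟨m, hm, hm'⟩ := hcon n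
    exact hm' (h.pow_smul_mem_mono hm hn)
  have hinj : Function.Injective fun n : ℕ => g⁻¹ ^ n • e := h.inv.pow_smul_injective
  refine Set.infinite_range_of_injective hinj ((t.sep_finite x (t.endpt e b)).subset ?_)
  rintro _ ⟨n, rfl⟩
  refine t.mem_sep_of_side (b := b) ?_ ?_
  · rw [mem_side_smul]; simpa using hx n
  · rw [mem_side_smul]
    have := h.pow_smul_mem_mono (Nat.zero_le n) (x := t.endpt e b) (by simpa using t.endpt_mem e b)
    simpa using this

/-- The translates of an attracting half-space have empty intersection. -/
theorem Shift.eventually_notMem {g : Γ} {e : E} {b : Bool} (h : t.Shift g e b) (x : X) :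
    ∃ n : ℕ, ∀ m ≥ n, x ∉ t.side (g ^ m • e) b := by
  obtain ⟨n, hn⟩ := h.inv.eventually_mem x
  refine ⟨n, fun m hm hx => ?_⟩
  have := hn m hm
  rw [mem_side_not] at this
  rw [mem_side_smul] at hx
  exact this (by simpa using hx)

theorem not_shift_of_smul_eq {g : Γ} {x : X} (hx : g • x = x) {e : E} {b : Bool} :
    ¬ t.Shift g e b := by
  intro h
  have hp : ∀ n : ℕ, g ^ n • x = x := by
    intro n
    induction n with
    | zero => simp
    | succ n ih => rw [pow_succ, mul_smul, hx, ih]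
  obtain ⟨n, hn⟩ := h.eventually_mem x
  obtain ⟨m, hm⟩ := h.eventually_notMem x
  have h1 := hn (max n m) (le_max_left _ _)
  have h2 := hm (max n m) (le_max_right _ _)
  rw [mem_side_smul] at h2
  rw [hp] at h1
  refine h2 ?_
  rwa [inv_smul_eq_iff.2 (hp (max n m)).symm]

theorem shift_or_eq_of_subset {g : Γ} {e : E} {b : Bool} (h : t.side (g • e) b ⊆ t.side e b) :
    t.Shift g e b ∨ g • e = e := by
  by_cases h' : t.side e b ⊆ t.side (g • e) b
  · exact .inr (t.side_injective (h.antisymm h'))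
  · exact .inl ⟨h, h'⟩

/-- An elliptic element moves a half-space missing one of its fixed vertices off itself, unless it
fixes the bounding edge. -/
theorem smul_eq_or_disjoint {g : Γ} {x : X} (hx : g • x = x) {e : E} {b : Bool}
    (hxe : x ∉ t.side e b) : g • e = e ∨ Disjoint (t.side (g • e) b) (t.side e b) := by
  have hx' : x ∉ t.side (g • e) b := by rwa [← hx, smul_mem_side]
  rcases t.side_trichotomy hx' hxe with h | h | h
  · exact .inr h
  · exact .inl ((shift_or_eq_of_subset h).resolve_left (not_shift_of_smul_eq hx))
  · have := t.side_smul_mono g⁻¹ h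
    rw [inv_smul_smul] at this
    have := (shift_or_eq_of_subset this).resolve_left
      (not_shift_of_smul_eq (inv_smul_eq_iff.2 hx.symm))
    exact .inl (inv_smul_eq_iff.1 this).symm

/-- The product of two elliptic elements is hyperbolic when some edge separating a fixed vertex of
one from a fixed vertex of the other is fixed by neither. -/
theorem shift_mul {g₁ g₂ : Γ} {x₁ x₂ : X} (h₁ : g₁ • x₁ = x₁) (h₂ : g₂ • x₂ = x₂) {e : E} {b : Bool}
    (hx₁ : x₁ ∉ t.side e b) (hx₂ : x₂ ∈ t.side e b) (he₁ : g₁ • e ≠ e) (he₂ : g₂ • e ≠ e) :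
    t.Shift (g₁ * g₂) e (!b) := by
  have d₁ := (smul_eq_or_disjoint h₁ hx₁).resolve_left he₁
  have d₂ := (smul_eq_or_disjoint h₂ (b := !b) (by simpa [mem_side_not] using hx₂)).resolve_left he₂
  have s₂ : t.side (g₂ • e) (!b) ⊆ t.side e b := by
    intro x hx
    by_contra hxe
    exact Set.disjoint_left.1 d₂ hx (t.mem_side_not.2 hxe)
  have s₁ := t.side_smul_mono g₁ s₂
  rw [← mul_smul] at s₁
  refine ⟨fun x hx => t.mem_side_not.2 (Set.disjoint_left.1 d₁ (s₁ hx)), fun h => ?_⟩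
  have := s₁ (h (t.mem_side_not.2 hx₁))
  rw [← h₁, smul_mem_side] at this
  exact hx₁ this

variable (t) in
/-- Every element is elliptic or hyperbolic: at a vertex with minimal displacement, either the
displacement is zero or the first edge towards the image is translated. -/
theorem exists_fixed_or_shift (c : Γ) (x₀ : X) : (∃ x : X, c • x = x) ∨ ∃ e b, t.Shift c e b := by
  have : Nonempty X := ⟨x₀⟩
  obtain ⟨x, hx⟩ : ∃ x : X, ∀ y : X, (t.sep x (c • x)).ncard ≤ (t.sep y (c • y)).ncard :=
    ⟨_, fun y => Function.argmin_le (fun x : X => (t.sep x (c • x)).ncard) y⟩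
  by_cases hcx : c • x = x
  · exact .inl ⟨x, hcx⟩
  right
  obtain ⟨e, b, rfl, hy⟩ := t.exists_endpt_eq_of_ne (Ne.symm hcx)
  refine ⟨e, b, ?_⟩
  rw [← endpt_smul] at hy
  have hxe := t.endpt_not_notMem e b
  have hne : c • e ≠ e := by
    intro h; rw [h] at hy; exact hxe hy
  have hy' : t.endpt (c • e) b ∈ t.side e b := (t.endpt_mem_side_iff hne _ _ _).1 hy
  by_cases hxc : t.endpt e (!b) ∈ t.side (c • e) b
  · exfalso
    -- The two edges point towards each other, so moving one step inwards decreases displacement.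
    have hxc' : t.endpt e b ∈ t.side (c • e) b := (t.endpt_mem_side_iff hne.symm _ _ _).1 hxc
    have hlt : (t.sep (t.endpt e b) (c • t.endpt e b)).ncard <
        (t.sep (t.endpt e (!b)) (c • t.endpt e (!b))).ncard := by
      refine Set.ncard_lt_ncard ⟨?_, fun h => ?_⟩ (t.sep_finite _ _)
      · intro f hf
        rw [← endpt_smul] at hf ⊢
        have hfe : f ≠ e := by
          rintro rfl
          have := t.endpt_mem f b
          cases b <;> simp_all [sep, side]
        have hfc : f ≠ c • e := by
          rintro rfl
          have := t.endpt_mem (c • e) b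
          cases b <;> simp_all [sep, side]
        have h1 := t.pos_iff f e hfe.symm
        have h2 := t.pos_iff f (c • e) hfc.symm
        cases b <;> simp_all [sep, endpt]
      · have : e ∈ t.sep (t.endpt e (!b)) (c • t.endpt e (!b)) :=
          t.mem_sep_of_side hxe (by rwa [← endpt_smul])
        have := h this
        rw [← endpt_smul] at this
        have h3 := t.endpt_mem e b
        cases b <;> simp_all [sep, side]
    exact absurd (hx (t.endpt e b)) (not_le.2 hlt)
  · refine ⟨t.side_subset_of_endpt_mem hne hy' hxe hxc, fun h => ?_⟩
    have h1 := h hy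
    rw [t.endpt_smul, smul_mem_side] at h1
    exact hxe h1

end Basic

end TreeAction

/-! ### Wide subgroups and acylindrical actions -/

/-- The subgroup `G` has only finitely many orbits meeting the set `A`. -/
def FiniteOrbitsOn {Γ α : Type*} [Group Γ] [MulAction Γ α] (G : Subgroup Γ) (A : Set α) : Prop :=
  ∃ Φ : Set α, Φ.Finite ∧ ∀ a ∈ A, ∃ g ∈ G, ∃ φ ∈ Φ, g • φ = a

theorem FiniteOrbitsOn.mono {Γ α : Type*} [Group Γ] [MulAction Γ α] {G : Subgroup Γ} {A B : Set α}
    (h : FiniteOrbitsOn G B) (hAB : A ⊆ B) : FiniteOrbitsOn G A := by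
  obtain ⟨Φ, hΦ, h⟩ := h
  exact ⟨Φ, hΦ, fun a ha => h a (hAB ha)⟩

theorem FiniteOrbitsOn.image {Γ α β : Type*} [Group Γ] [MulAction Γ α] [MulAction Γ β]
    {G : Subgroup Γ} {A : Set α} (h : FiniteOrbitsOn G A) (f : α → β)
    (hf : ∀ (g : Γ) a, f (g • a) = g • f a) : FiniteOrbitsOn G (f '' A) := by
  obtain ⟨Φ, hΦ, h⟩ := h
  refine ⟨f '' Φ, hΦ.image f, ?_⟩
  rintro _ ⟨a, ha, rfl⟩
  obtain ⟨g, hg, φ, hφ, rfl⟩ := h a ha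
  exact ⟨g, hg, f φ, ⟨φ, hφ, rfl⟩, (hf g φ).symm⟩

theorem FiniteOrbitsOn.union {Γ α : Type*} [Group Γ] [MulAction Γ α] {G : Subgroup Γ} {A B : Set α}
    (hA : FiniteOrbitsOn G A) (hB : FiniteOrbitsOn G B) : FiniteOrbitsOn G (A ∪ B) := by
  obtain ⟨Φ, hΦ, h⟩ := hA
  obtain ⟨Ψ, hΨ, h'⟩ := hB
  refine ⟨Φ ∪ Ψ, hΦ.union hΨ, ?_⟩
  rintro a (ha | ha)
  · obtain ⟨g, hg, φ, hφ, e⟩ := h a ha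
    exact ⟨g, hg, φ, .inl hφ, e⟩
  · obtain ⟨g, hg, φ, hφ, e⟩ := h' a ha
    exact ⟨g, hg, φ, .inr hφ, e⟩

/-- A subgroup is wide if it contains a non-trivial normal subgroup, or if it has finitely many
double cosets with some cyclic subgroup. Both conditions force finite index for finitely generated
subgroups of groups in the class, and the second one is what makes the induction on the level
work. -/
def Subgroup.IsWide {Γ : Type*} [Group Γ] (G : Subgroup Γ) : Prop :=
  (∃ N : Subgroup Γ, N.Normal ∧ N ≠ ⊥ ∧ N ≤ G) ∨
    ∃ (c : Γ) (F : Set Γ), F.Finite ∧ ∀ γ : Γ, ∃ g ∈ G, ∃ f ∈ F, ∃ j : ℤ, γ = g * f * c ^ j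

namespace TreeAction

section Acylindrical

variable {Γ X E : Type*} [Group Γ] [MulAction Γ X] [MulAction Γ E] {t : TreeAction Γ X E}

variable (t) in
/-- The action is `k`-acylindrical: only the identity fixes two vertices separated by more than `k`
edges. -/
def Acylindrical (k : ℕ) : Prop :=
  ∀ (x y : X) (g : Γ), k < (t.sep x y).ncard → g • x = x → g • y = y → g = 1

variable (t) in
/-- The edges of the subtree spanned by a set of vertices. -/
def hull (Q : Set X) : Set E := {e | ∃ x ∈ Q, ∃ y ∈ Q, e ∈ t.sep x y}

/-- An element fixing a vertex outside an attracting half-space and a translated edge far inside it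
is trivial. -/
theorem Acylindrical.eq_one {k : ℕ} (ht : t.Acylindrical k) {h : Γ} {e : E} {b : Bool}
    (hs : t.Shift h e b) {g : Γ} {x : X} (hx : x ∉ t.side e b) (hgx : g • x = x) {i : ℕ}
    (hi : k ≤ i) (hg : g • (h ^ i • e) = h ^ i • e) : g = 1 := by
  refine ht x (t.endpt (h ^ i • e) b) g ?_ hgx (by rw [← t.endpt_smul, hg])
  have hsub : (fun j : ℕ => h ^ j • e) '' (Finset.range (i + 1) : Set ℕ) ⊆
      t.sep x (t.endpt (h ^ i • e) b) := by
    rintro _ ⟨j, hj, rfl⟩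
    have hj' : j ≤ i := by simpa [Nat.lt_succ_iff] using hj
    refine t.mem_sep_of_side (b := b) (fun hxj => hx ?_) (hs.anti hj' (t.endpt_mem _ _))
    simpa using hs.anti (Nat.zero_le j) hxj
  have := Set.ncard_le_ncard hsub (t.sep_finite _ _)
  rw [Set.ncard_image_of_injective _ hs.pow_smul_injective, Set.ncard_coe_finset,
    Finset.card_range] at this
  omega

theorem Acylindrical.eventually_ne {k : ℕ} (ht : t.Acylindrical k) {h : Γ} {e : E} {b : Bool}
    (hs : t.Shift h e b) {n : Γ} (hn : n ≠ 1) {x : X} (hx : n • x = x) :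
    ∃ I : ℕ, ∀ i ≥ I, n • (h ^ i • e) ≠ h ^ i • e ∧ x ∉ t.side (h ^ i • e) b := by
  obtain ⟨m, hm⟩ := hs.eventually_notMem x
  refine ⟨m + k, fun i hi => ⟨fun hfix => hn ?_, hm i (by omega)⟩⟩
  refine ht.eq_one (hs.translate m) (hm m le_rfl) hx (i := i - m) (by omega) ?_
  rwa [← mul_smul (h ^ (i - m)), ← pow_add, Nat.sub_add_cancel (by omega)]

/-- A non-trivial normal subgroup contains a hyperbolic element: if `n` is elliptic, then its
product with a distant conjugate is hyperbolic. -/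
theorem Acylindrical.exists_shift_mem {k : ℕ} (ht : t.Acylindrical k) {h : Γ} {e : E} {b : Bool}
    (hs : t.Shift h e b) {N : Subgroup Γ} (hN : N.Normal) (hne : N ≠ ⊥) :
    ∃ n ∈ N, ∃ e b, t.Shift n e b := by
  obtain ⟨n, hnN, hn⟩ := N.bot_or_exists_ne_one.resolve_left hne
  obtain ⟨x, hx⟩ | ⟨e, b, hs'⟩ := t.exists_fixed_or_shift n (t.src e)
  swap
  · exact ⟨n, hnN, e, b, hs'⟩
  obtain ⟨I, hI⟩ := ht.eventually_ne hs hn hx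
  obtain ⟨J, hJ⟩ := ht.eventually_ne hs.inv hn hx
  set m := max I J
  obtain ⟨h1, h2⟩ := hI m (le_max_left _ _)
  obtain ⟨h3, h4⟩ := hJ m (le_max_right _ _)
  rw [mem_side_not, not_not] at h4
  have hm : h ^ (2 * m) • (h⁻¹ ^ m • e) = h ^ m • e := by
    rw [← mul_smul]; congr 1
    rw [two_mul, pow_add, inv_pow, mul_inv_cancel_right]
  refine ⟨n * (h ^ (2 * m) * n * (h ^ (2 * m))⁻¹), N.mul_mem hnN (hN.conj_mem n hnN _), h ^ m • e,
    !b, shift_mul (x₂ := h ^ (2 * m) • x) hx (by simp [mul_smul, hx]) h2 ?_ h1 ?_⟩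
  · rw [← hm, smul_mem_side]; exact h4
  · intro h5
    rw [← hm, mul_smul, inv_smul_smul, mul_smul] at h5
    exact h3 (smul_left_cancel _ h5)

/-- If the stabilizer of `v` is proper and fixes no edge, there is a hyperbolic element, namely a
product of an element fixing `v` and an element fixing another vertex of its orbit. -/
theorem exists_shift {v : X} (hedge : ∀ e : E, ∃ a : Γ, a • v = v ∧ a • e ≠ e)
    (hne : ∃ γ : Γ, γ • v ≠ v) : ∃ (h : Γ) (e : E) (b : Bool), t.Shift h e b := by
  obtain ⟨γ, hγ⟩ := hne
  obtain ⟨e, b, he, hb⟩ := t.exists_endpt_eq_of_ne hγ.symm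
  obtain ⟨a, hav, hae⟩ := hedge e
  obtain ⟨a', hav', hae'⟩ := hedge (γ⁻¹ • e)
  refine ⟨a * (γ * a' * γ⁻¹), e, !b, shift_mul (x₂ := γ • v) hav (by simp [mul_smul, hav']) ?_ hb
    hae ?_⟩
  · rw [← he]; exact t.endpt_not_notMem _ _
  · intro h
    rw [mul_smul, mul_smul] at h
    exact hae' (eq_inv_smul_iff.2 h)

theorem smul_mem_hull {Q : Set X} {G : Subgroup Γ} (hQ : ∀ g ∈ G, ∀ x ∈ Q, g • x ∈ Q) {g : Γ}
    (hg : g ∈ G) {e : E} : g • e ∈ t.hull Q ↔ e ∈ t.hull Q := by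
  constructor
  · rintro ⟨x, hx, y, hy, h⟩
    refine ⟨g⁻¹ • x, hQ _ (G.inv_mem hg) _ hx, g⁻¹ • y, hQ _ (G.inv_mem hg) _ hy, ?_⟩
    rw [← t.smul_mem_sep g]; simpa using h
  · rintro ⟨x, hx, y, hy, h⟩
    exact ⟨g • x, hQ _ hg _ hx, g • y, hQ _ hg _ hy, (t.smul_mem_sep g).2 h⟩

/-- The subtree spanned by finitely many orbits of a finitely generated group is cofinite. -/
theorem finiteOrbitsOn_hull {G : Subgroup Γ} (hG : G.FG) {Q : Set X} (hQ : FiniteOrbitsOn G Q) :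
    FiniteOrbitsOn G (t.hull Q) := by
  obtain ⟨Φ, hΦ, hQ⟩ := hQ
  obtain ⟨S, hS⟩ := hG
  rcases Φ.eq_empty_or_nonempty with rfl | ⟨q, hq⟩
  · exact ⟨∅, Set.finite_empty, fun e ⟨x, hx, _⟩ => by simpa using hQ x hx⟩
  set Ψ : Set E := (⋃ s ∈ S, t.sep q (s • q)) ∪ ⋃ φ ∈ Φ, t.sep q φ with hΨ
  have hΨf : Ψ.Finite := (S.finite_toSet.biUnion fun _ _ => t.sep_finite _ _).union
    (hΦ.biUnion fun _ _ => t.sep_finite _ _)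
  have key : ∀ g ∈ G, ∀ e ∈ t.sep q (g • q), ∃ g' ∈ G, ∃ φ ∈ Ψ, g' • φ = e := by
    intro g hg
    have hg' := hg
    rw [← hS] at hg'
    induction hg' using Subgroup.closure_induction with
    | mem s hs =>
      intro e he
      exact ⟨1, G.one_mem, e, .inl (Set.mem_biUnion hs he), one_smul _ _⟩
    | one => intro e he; simp [sep_self] at he
    | mul a b ha hb iha ihb =>
      rw [hS] at ha hb
      intro e he
      rcases t.sep_subset _ (a • q) _ he with h | h
      · exact iha ha e h
      · rw [← smul_inv_smul a e, mul_smul, smul_mem_sep] at h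
        obtain ⟨g', hg', φ, hφ, h'⟩ := ihb hb _ h
        exact ⟨a * g', G.mul_mem ha hg', φ, hφ, by rw [mul_smul, h', smul_inv_smul]⟩
    | inv a ha iha =>
      rw [hS] at ha
      intro e he
      have : a • e ∈ t.sep q (a • q) := by
        rw [← t.smul_mem_sep a, smul_inv_smul, sep_comm] at he
        exact he
      obtain ⟨g', hg', φ, hφ, h'⟩ := iha ha _ this
      exact ⟨a⁻¹ * g', G.mul_mem (G.inv_mem ha) hg', φ, hφ, by rw [mul_smul, h', inv_smul_smul]⟩
  have key' : ∀ x ∈ Q, ∀ e ∈ t.sep q x, ∃ g' ∈ G, ∃ φ ∈ Ψ, g' • φ = e := by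
    intro x hx e he
    obtain ⟨g, hg, φ, hφ, rfl⟩ := hQ x hx
    rcases t.sep_subset _ (g • q) _ he with h | h
    · exact key g hg e h
    · rw [← smul_inv_smul g e, smul_mem_sep] at h
      exact ⟨g, hg, _, .inr (Set.mem_biUnion hφ h), smul_inv_smul _ _⟩
  refine ⟨Ψ, hΨf, ?_⟩
  rintro e ⟨x, hx, y, hy, he⟩
  rcases t.sep_subset _ q _ he with h | h
  · exact key' x hx e (by rwa [sep_comm])
  · exact key' y hy e h

/-- If `G` contains a normal subgroup with a hyperbolic element, then every `G`-invariant subtree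
contains all translates of the axis of that element. -/
theorem finiteOrbitsOn_orbit_of_normal {G N : Subgroup Γ} (hG : G.FG) (hN : N.Normal) (hNG : N ≤ G)
    {n : Γ} (hn : n ∈ N) {e : E} {b : Bool} (hs : t.Shift n e b) :
    ∃ p : X, FiniteOrbitsOn G (MulAction.orbit Γ p) := by
  have hQ : FiniteOrbitsOn G {x | ∃ g ∈ G, g • t.src e = x} :=
    ⟨{t.src e}, Set.finite_singleton _, fun x ⟨g, hg, h⟩ => ⟨g, hg, _, rfl, h⟩⟩
  have hull := finiteOrbitsOn_hull (t := t) hG hQ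
  have hsub : MulAction.orbit Γ e ⊆ t.hull {x | ∃ g ∈ G, g • t.src e = x} := by
    rintro _ ⟨γ, rfl⟩
    have hc := hNG (hN.conj_mem n hn γ)
    obtain ⟨i, hi⟩ := (hs.conj γ).eventually_mem (t.src e)
    obtain ⟨j, hj⟩ := (hs.conj γ).inv.eventually_mem (t.src e)
    exact ⟨_, ⟨_, G.pow_mem (G.inv_mem hc) j, rfl⟩, _, ⟨_, G.pow_mem hc i, rfl⟩,
      t.mem_sep_of_side (t.mem_side_not.1 (hj j le_rfl)) (hi i le_rfl)⟩
  refine ⟨t.src e, ((hull.mono hsub).image t.src t.src_smul).mono ?_⟩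
  rintro _ ⟨γ, rfl⟩
  exact ⟨γ • e, ⟨γ, rfl⟩, t.src_smul _ _⟩

/-- If `G` has finitely many orbits on one vertex orbit of the whole group, it has finitely many on
the orbit of some edge at `v`. -/
theorem exists_edge_finiteOrbitsOn {G : Subgroup Γ} (hG : G.FG) {v : X}
    (hedge : ∀ e : E, ∃ a : Γ, a • v = v ∧ a • e ≠ e) (hne : ∃ γ : Γ, γ • v ≠ v)
    {p : X} (hp : FiniteOrbitsOn G (MulAction.orbit Γ p)) :
    ∃ (e : E) (b : Bool), t.endpt e b = v ∧ FiniteOrbitsOn G (MulAction.orbit Γ e) := by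
  obtain ⟨q, hq, hqv⟩ : ∃ q ∈ MulAction.orbit Γ p, v ≠ q := by
    by_cases h : v = p
    · subst h
      obtain ⟨γ, hγ⟩ := hne
      exact ⟨γ • v, ⟨γ, rfl⟩, hγ.symm⟩
    · exact ⟨p, MulAction.mem_orbit_self p, h⟩
  obtain ⟨e, b, he, hb⟩ := t.exists_endpt_eq_of_ne hqv
  have hve : v ∉ t.side e b := by rw [← he]; exact t.endpt_not_notMem _ _
  refine ⟨e, !b, he, (finiteOrbitsOn_hull (t := t) hG hp).mono ?_⟩
  obtain ⟨a, hav, hae⟩ := hedge e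
  have hd := (smul_eq_or_disjoint hav hve).resolve_left hae
  have haq : a • q ∉ t.side e b := Set.disjoint_left.1 hd ((t.smul_mem_side a).2 hb)
  have hmem : e ∈ t.hull (MulAction.orbit Γ p) :=
    ⟨_, MulAction.mem_orbit_of_mem_orbit a hq, q, hq, t.mem_sep_of_side haq hb⟩
  rintro _ ⟨γ, rfl⟩
  exact (smul_mem_hull (G := ⊤) (fun g _ x hx => MulAction.mem_orbit_of_mem_orbit g hx)
    (Subgroup.mem_top γ)).2 hmem

end Acylindrical

end TreeAction

/-! ### Rays along the axis of a hyperbolic element -/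

namespace TreeAction

section Rays

variable {Γ X E : Type*} [Group Γ] [MulAction Γ X] [MulAction Γ E] {t : TreeAction Γ X E}

variable (t) in
/-- The sequence `p, d • p, d ^ 2 • p, …` runs along the axis of the hyperbolic element `d`: as soon
as it enters a half-space not containing `p`, that half-space contains a translate of the
attracting half-space `side e b`. -/
def IsRay (d : Γ) (e : E) (b : Bool) (p : X) : Prop :=
  t.Shift d e b ∧ ∀ (a : E) (b' : Bool) (i : ℕ), p ∉ t.side a b' → d ^ i • p ∈ t.side a b' →
    t.side (d ^ i • e) b ⊆ t.side a b'

theorem Shift.isRay {c : Γ} {e : E} {b : Bool} (h : t.Shift c e b) :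
    t.IsRay c e b (t.endpt e b) := by
  refine ⟨h, fun a b' i hp hi => ?_⟩
  have hi0 : i ≠ 0 := by rintro rfl; exact hp (by simpa using hi)
  have hne : e ≠ c ^ i • e := by
    intro h0
    exact hi0 (h.pow_smul_injective (a₁ := i) (a₂ := 0) (by simpa using h0.symm))
  have hp' : t.endpt e b ∉ t.side (c ^ i • e) b := by
    rw [t.endpt_mem_side_iff hne b b (!b)]
    intro h0
    have := h.anti (Nat.zero_le i) h0
    rw [pow_zero, one_smul] at this
    exact t.endpt_not_notMem _ _ this
  rw [← endpt_smul] at hi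
  by_cases ha : c ^ i • e = a
  · subst ha
    by_cases hb : b' = b
    · rw [hb]
    · have : b = !b' := by cases b <;> cases b' <;> simp_all
      subst this
      exact absurd hi (t.endpt_not_notMem _ _)
  · exact t.side_subset_of_endpt_mem ha hi hp hp'

theorem Shift.isRay_inv {c : Γ} {e : E} {b : Bool} (h : t.Shift c e b) :
    t.IsRay c⁻¹ e (!b) (t.endpt e b) := by
  refine ⟨h.inv, fun a b' i hp hi => ?_⟩
  have hp' : t.endpt e b ∉ t.side (c⁻¹ ^ i • e) (!b) := by
    intro h0
    have := h.inv.anti (Nat.zero_le i) h0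
    rw [pow_zero, one_smul, mem_side_not] at this
    exact this (t.endpt_mem _ _)
  rw [← endpt_smul] at hi
  by_cases ha : c⁻¹ ^ i • e = a
  · subst ha
    by_cases hb : b' = b
    · subst hb; exact absurd (not_not.1 (fun h => hp' (t.mem_side_not.2 h))) hp
    · have : b = !b' := by cases b <;> cases b' <;> simp_all
      subst this
      exact absurd hi (t.endpt_not_notMem _ _)
  · exact t.side_subset_of_endpt_mem ha hi hp hp'

theorem IsRay.eventually_mem {d : Γ} {e : E} {b : Bool} {p : X} (h : t.IsRay d e b p) {γ : Γ} {a : E}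
    {b' : Bool} {i : ℕ} (hp : γ • p ∉ t.side a b') (hi : γ • d ^ i • p ∈ t.side a b') :
    ∃ n : ℕ, ∀ m ≥ n, γ • d ^ m • p ∈ t.side a b' := by
  rw [← smul_inv_smul γ a, smul_mem_side] at hp hi
  obtain ⟨n, hn⟩ := (h.1.translate i).eventually_mem p
  refine ⟨n, fun m hm => ?_⟩
  rw [← smul_inv_smul γ a, smul_mem_side]
  exact h.2 _ _ i hp hi (hn m hm)

/-- The generator `c` of a cyclic group, or its inverse. -/
def dir (c : Γ) (ε : Bool) : Γ := bif ε then c else c⁻¹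

theorem exists_dir_pow_eq_zpow (c : Γ) (j : ℤ) : ∃ (ε : Bool) (n : ℕ), c ^ j = dir c ε ^ n := by
  obtain ⟨n, rfl | rfl⟩ := j.eq_nat_or_neg
  · exact ⟨true, n, by simp [dir]⟩
  · exact ⟨false, n, by simp [dir]⟩

/-- If all rays `f • dir c ε ^ n • p` with `f ∈ F` returned to the subtree spanned by `G F p`, then
`G` would have finitely many orbits on the orbit of `p`. -/
theorem exists_side_avoiding {G : Subgroup Γ} (hG : G.FG) {c : Γ} {F : Set Γ} (hF : F.Finite)
    (hGF : ∀ γ : Γ, ∃ g ∈ G, ∃ f ∈ F, ∃ j : ℤ, γ = g * f * c ^ j) {e : E} {β : Bool → Bool} {p : X}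
    (hray : ∀ ε, t.IsRay (dir c ε) e (β ε) p)
    (hcon : ¬ FiniteOrbitsOn G (MulAction.orbit Γ p)) :
    ∃ f ∈ F, ∃ (ε : Bool) (i : ℕ), ∀ g ∈ G, ∀ f' ∈ F,
      g • f' • p ∉ t.side (f • dir c ε ^ i • e) (β ε) := by
  by_contra h
  push Not at h
  refine hcon ?_
  set P : Set X := {x | ∃ g ∈ G, ∃ f ∈ F, g • f • p = x} with hP
  have hPG : ∀ g ∈ G, ∀ x ∈ P, g • x ∈ P := by
    rintro g hg _ ⟨g', hg', f, hf, rfl⟩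
    exact ⟨g * g', G.mul_mem hg hg', f, hf, mul_smul _ _ _⟩
  have hPfin : FiniteOrbitsOn G P := by
    refine ⟨(fun f => f • p) '' F, hF.image _, ?_⟩
    rintro _ ⟨g, hg, f, hf, rfl⟩
    exact ⟨g, hg, _, ⟨f, hf, rfl⟩, rfl⟩
  have hull := finiteOrbitsOn_hull (t := t) hG hPfin
  refine ((hPfin.union (hull.image (fun e => t.endpt e true) fun g e => t.endpt_smul g e true)).union
    (hull.image (fun e => t.endpt e false) fun g e => t.endpt_smul g e false)).mono ?_
  rintro _ ⟨γ, rfl⟩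
  obtain ⟨g, hg, f, hf, j, rfl⟩ := hGF γ
  obtain ⟨ε, n, hn⟩ := exists_dir_pow_eq_zpow c j
  rw [hn]
  change (g * f * dir c ε ^ n) • p ∈ _
  rw [mul_smul, mul_smul]
  by_cases hnp : dir c ε ^ n • p = p
  · rw [hnp]; exact .inl (.inl ⟨g, hg, f, hf, rfl⟩)
  obtain ⟨a, b, ha, hb⟩ := t.exists_endpt_eq_of_ne hnp
  have h1 : p ∉ t.side a (!b) := fun h => t.mem_side_not.1 h hb
  have h2 : dir c ε ^ n • p ∈ t.side a (!b) := by rw [← ha]; exact t.endpt_mem _ _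
  obtain ⟨g', hg', f', hf', hx⟩ := h f hf ε n
  have h3 := t.side_smul_mono f ((hray ε).2 a (!b) n h1 h2) hx
  have h4 : f • a ∈ t.hull P := by
    refine ⟨f • p, ⟨1, G.one_mem, f, hf, one_smul _ _⟩, _, ⟨g', hg', f', hf', rfl⟩,
      t.mem_sep_of_side (b := !b) ?_ h3⟩
    rwa [smul_mem_side]
  have h5 : g • f • a ∈ t.hull P := (smul_mem_hull hPG hg).2 h4
  have h6 : t.endpt (g • f • a) (!b) = g • f • dir c ε ^ n • p := by
    rw [endpt_smul, endpt_smul, ha]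
  cases b
  · exact .inl (.inr ⟨_, h5, h6⟩)
  · exact .inr ⟨_, h5, h6⟩

/-- If `G` has finitely many double cosets with the cyclic group generated by `c`, then `G` has
finitely many orbits on some vertex orbit. When `c` is hyperbolic and this fails, some half-space
`H` of an axis avoids the orbits `G F p`; by acylindricity its translates under `G` are eventually
disjoint, so only finitely many of the rays covering the orbit of `p` enter `H`. Far out, they all
converge to the same end as `H`, so every conjugate of `c` has this end as one of its two limits,
and the orbit of the end has at most two elements. A vertex stabilizer with three elements
then contains a non-trivial element fixing a whole ray, contrary to acylindricity. -/
theorem finiteOrbitsOn_orbit_of_cyclic {k : ℕ} (ht : t.Acylindrical k) {G : Subgroup Γ} (hG : G.FG)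
    {c : Γ} {F : Set Γ} (hF : F.Finite)
    (hGF : ∀ γ : Γ, ∃ g ∈ G, ∃ f ∈ F, ∃ j : ℤ, γ = g * f * c ^ j) {v : X} {a : Fin 3 → Γ}
    (ha : Function.Injective a) (hav : ∀ i, a i • v = v) :
    ∃ p : X, FiniteOrbitsOn G (MulAction.orbit Γ p) := by
  obtain ⟨x, hx⟩ | ⟨e, b, hs⟩ := t.exists_fixed_or_shift c v
  · refine ⟨x, (fun f => f • x) '' F, hF.image _, ?_⟩
    rintro _ ⟨γ, rfl⟩
    obtain ⟨g, hg, f, hf, j, rfl⟩ := hGF γ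
    refine ⟨g, hg, _, ⟨f, hf, rfl⟩, ?_⟩
    have : c ^ j • x = x := by
      have : c ∈ MulAction.stabilizer Γ x := hx
      exact (MulAction.stabilizer Γ x).zpow_mem this j
    simp [mul_smul, this]
  set p := t.endpt e b
  refine ⟨p, ?_⟩
  set β : Bool → Bool := fun ε => bif ε then b else !b
  have hray : ∀ ε, t.IsRay (dir c ε) e (β ε) p := by
    rintro (_ | _)
    · exact hs.isRay_inv
    · exact hs.isRay
  by_contra hcon
  obtain ⟨f₀, hf₀, ε₀, i₀, hP⟩ := exists_side_avoiding hG hF hGF hray hcon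
  -- The half-space `H = side e₀ b₀` avoiding `G F p`, and the hyperbolic element `d` shrinking it.
  obtain ⟨d, hd⟩ : ∃ d, d = f₀ * dir c ε₀ * f₀⁻¹ := ⟨_, rfl⟩
  obtain ⟨e₀, he₀⟩ : ∃ e₀, e₀ = f₀ • dir c ε₀ ^ i₀ • e := ⟨_, rfl⟩
  obtain ⟨b₀, hb₀⟩ : ∃ b₀, b₀ = β ε₀ := ⟨_, rfl⟩
  have hds : t.Shift d e₀ b₀ := by
    rw [hd, he₀, hb₀]; exact ((hray ε₀).1.translate i₀).conj f₀
  rw [← he₀, ← hb₀] at hP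
  have hP' : ∀ g ∈ G, ∀ f ∈ F, ∀ m : ℕ, g • f • p ∉ t.side (d ^ m • e₀) b₀ := by
    intro g hg f hf m h
    exact hP g hg f hf (by simpa using hds.anti (Nat.zero_le m) h)
  have hmeet : ∀ g ∈ G, ∀ (m : ℕ) (x : X), x ∈ t.side (g • d ^ m • e₀) b₀ →
      x ∈ t.side (d ^ m • e₀) b₀ → g • d ^ m • e₀ = d ^ m • e₀ := by
    intro g hg m x h1 h2
    have hno : ∀ g ∈ G, ¬ t.Shift g (d ^ m • e₀) b₀ := by
      intro g hg h
      obtain ⟨n, hn⟩ := h.eventually_mem (f₀ • p)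
      exact hP' _ (G.pow_mem hg n) f₀ hf₀ m (hn n le_rfl)
    have hz : f₀ • p ∉ t.side (g • d ^ m • e₀) b₀ := by
      rw [mem_side_smul]; exact hP' _ (G.inv_mem hg) f₀ hf₀ m
    have hz' : f₀ • p ∉ t.side (d ^ m • e₀) b₀ := by
      simpa using hP' 1 G.one_mem f₀ hf₀ m
    rcases t.side_trichotomy hz hz' with h | h | h
    · exact absurd h2 (Set.disjoint_left.1 h h1)
    · exact (shift_or_eq_of_subset h).resolve_left (hno g hg)
    · have := t.side_smul_mono g⁻¹ h
      rw [inv_smul_smul] at this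
      have := (shift_or_eq_of_subset this).resolve_left (hno _ (G.inv_mem hg))
      exact (inv_smul_eq_iff.1 this).symm
  have hone : ∀ g ∈ G, ∀ x : X, x ∈ t.side (g • d ^ k • e₀) b₀ →
      x ∈ t.side (d ^ k • e₀) b₀ → g = 1 := by
    intro g hg x h1 h2
    have e1 := hmeet g hg k x h1 h2
    have e2 := hmeet g hg 0 x (t.side_smul_mono g (hds.anti (Nat.zero_le k)) h1)
      (hds.anti (Nat.zero_le k) h2)
    rw [pow_zero, one_smul] at e2
    exact ht.eq_one hds (t.endpt_not_notMem e₀ b₀) (by rw [← endpt_smul, e2]) le_rfl e1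
  -- A ray entering a sufficiently small half-space converges to its end.
  have hM : ∀ (f : Γ) (ε : Bool), ∃ M : ℕ, f ∈ F → ∀ g ∈ G,
      (∃ j : ℕ, g • f • dir c ε ^ j • p ∈ t.side (d ^ M • e₀) b₀) →
      ∀ m : ℕ, ∃ j : ℕ, g • f • dir c ε ^ j • p ∈ t.side (d ^ m • e₀) b₀ := by
    intro f ε
    by_contra h
    push Not at h
    obtain ⟨hf, g₁, hg₁, ⟨j₁, hj₁⟩, m₀, hm₀⟩ := h k
    obtain ⟨-, g₂, hg₂, ⟨j₂, hj₂⟩, -⟩ := h (max k m₀)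
    have hj₂' := hds.anti (le_max_left _ _) hj₂
    obtain ⟨n₁, hn₁⟩ := (hray ε).eventually_mem (γ := g₁ * f) (i := j₁)
      (by rw [mul_smul]; exact hP' g₁ hg₁ f hf k) (by rwa [mul_smul])
    obtain ⟨n₂, hn₂⟩ := (hray ε).eventually_mem (γ := g₂ * f) (i := j₂)
      (by rw [mul_smul]; exact hP' g₂ hg₂ f hf k) (by rwa [mul_smul])
    have h1 := hn₁ (max n₁ n₂) (le_max_left _ _)
    have h2 := hn₂ (max n₁ n₂) (le_max_right _ _)
    have hg : g₁ * g₂⁻¹ = 1 := by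
      refine hone _ (G.mul_mem hg₁ (G.inv_mem hg₂)) _ ?_ h1
      rw [mem_side_smul]
      convert h2 using 1
      simp [mul_smul]
    have : g₁ = g₂ := mul_inv_eq_one.1 hg
    subst this
    exact hm₀ j₂ (hds.anti (le_max_right _ _) hj₂)
  choose M hM using hM
  obtain ⟨M₀, hM₀⟩ : ∃ M₀ : ℕ, ∀ f ∈ F, ∀ ε, M f ε ≤ M₀ := by
    refine ⟨hF.toFinset.sup fun f => max (M f true) (M f false), fun f hf ε => ?_⟩
    refine le_trans ?_ (Finset.le_sup (f := fun f => max (M f true) (M f false))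
      (hF.mem_toFinset.2 hf))
    cases ε
    · exact le_max_right _ _
    · exact le_max_left _ _
  -- Of the two rays along the axis of a conjugate of `c`, one converges to the end of `H`.
  have hend : ∀ γ : Γ, ∃ ε : Bool, ∀ m : ℕ, ∃ n : ℕ, ∀ j ≥ n,
      γ • dir c ε ^ j • p ∈ t.side (d ^ m • e₀) b₀ := by
    intro γ
    obtain ⟨n, hn⟩ := (hds.translate M₀).eventually_mem (γ • p)
    have hn := hn n le_rfl
    obtain ⟨g, hg, f, hf, j₁, hγ⟩ := hGF (d ^ n * γ)
    obtain ⟨ε, n₁, hn₁⟩ := exists_dir_pow_eq_zpow c j₁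
    rw [hn₁] at hγ
    have hent := hM f ε hf g hg ⟨n₁, by
      refine hds.anti (hM₀ f hf ε) ?_
      rwa [← mul_smul, hγ, mul_smul, mul_smul] at hn⟩
    refine ⟨ε, fun m => ?_⟩
    obtain ⟨i, hi⟩ := hent (n + m)
    obtain ⟨L, hL⟩ := (hray ε).eventually_mem (γ := g * f) (i := i)
      (by rw [mul_smul]; exact hP' g hg f hf (n + m)) (by rwa [mul_smul])
    refine ⟨L, fun j hj => ?_⟩
    have := hL (n₁ + j) (by omega)
    have h1 : (g * f) • dir c ε ^ (n₁ + j) • p = d ^ n • γ • dir c ε ^ j • p := by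
      rw [pow_add, mul_smul (dir c ε ^ n₁), ← mul_smul (g * f), ← hγ, mul_smul]
    rw [h1, pow_add, mul_smul (d ^ n) (d ^ m), smul_mem_side] at this
    exact this
  choose ε hε using fun i => hend (a i)⁻¹
  obtain ⟨i, j, hij, hεij⟩ := Fintype.exists_ne_map_eq_of_card_lt ε (by simp)
  obtain ⟨m₀, hm₀⟩ := hds.eventually_notMem v
  obtain ⟨n₁, hn₁⟩ := hε i (k + m₀)
  obtain ⟨n₂, hn₂⟩ := hε j (k + m₀)
  have h1 := hn₁ (max n₁ n₂) (le_max_left _ _)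
  have h2 := hn₂ (max n₁ n₂) (le_max_right _ _)
  rw [← hεij] at h2
  have hgv : ((a i)⁻¹ * a j) • v = v := by
    rw [mul_smul, hav, inv_smul_eq_iff, hav]
  have hfix := (smul_eq_or_disjoint hgv (hm₀ (k + m₀) (by omega))).resolve_right (by
    rw [Set.not_disjoint_iff]
    refine ⟨_, ?_, h1⟩
    rw [mem_side_smul]
    convert h2 using 1
    simp [mul_smul])
  rw [pow_add, mul_smul (d ^ k)] at hfix
  have hone' := ht.eq_one (hds.translate m₀) (hm₀ m₀ le_rfl) hgv le_rfl hfix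
  exact hij (ha (inv_mul_eq_one.1 hone'))

/-- A finitely generated wide subgroup has finitely many orbits on the orbit of some edge at `v`,
if the stabilizer of `v` is a proper subgroup, has at least three elements, and fixes no edge. -/
theorem exists_edge_finiteOrbitsOn_of_isWide {k : ℕ} (ht : t.Acylindrical k) {G : Subgroup Γ}
    (hG : G.FG) (hw : G.IsWide) {v : X} {a : Fin 3 → Γ} (ha : Function.Injective a)
    (hav : ∀ i, a i • v = v) (hedge : ∀ e : E, ∃ a : Γ, a • v = v ∧ a • e ≠ e)
    (hne : ∃ γ : Γ, γ • v ≠ v) :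
    ∃ (e : E) (b : Bool), t.endpt e b = v ∧ FiniteOrbitsOn G (MulAction.orbit Γ e) := by
  suffices ∃ p : X, FiniteOrbitsOn G (MulAction.orbit Γ p) from
    exists_edge_finiteOrbitsOn hG hedge hne this.choose_spec
  rcases hw with ⟨N, hN, hN1, hNG⟩ | ⟨c, F, hF, hGF⟩
  · obtain ⟨h, e, b, hs⟩ := exists_shift (t := t) hedge hne
    obtain ⟨n, hn, e', b', hs'⟩ := ht.exists_shift_mem hs hN hN1
    exact finiteOrbitsOn_orbit_of_normal hG hN hNG hn hs'
  · exact finiteOrbitsOn_orbit_of_cyclic ht hG hF hGF ha hav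

end Rays

end TreeAction

/-! ### Finite generation of vertex stabilizers -/

namespace TreeAction

section VertexStabilizer

variable {Γ X E : Type*} [Group Γ] [MulAction Γ X] [MulAction Γ E] {t : TreeAction Γ X E}

/-- Edges at `v` with the same orientation that lie in one orbit of `G` lie in one orbit of the
stabilizer of `v` in `G`. -/
theorem finiteOrbitsOn_stabilizer {G : Subgroup Γ} {v : X} {A : Set E} (b : Bool)
    (hA : ∀ e ∈ A, t.endpt e b = v) (h : FiniteOrbitsOn G A) :
    FiniteOrbitsOn (G ⊓ MulAction.stabilizer Γ v) A := by
  obtain ⟨Φ, hΦ, h⟩ := h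
  have hr : ∀ φ : E, ∃ r : E, (∃ g ∈ G, g • φ ∈ A) → r ∈ A ∧ ∃ g ∈ G, g • φ = r := by
    intro φ
    by_cases hφ : ∃ g ∈ G, g • φ ∈ A
    · obtain ⟨g, hg, hgA⟩ := hφ
      exact ⟨g • φ, fun _ => ⟨hgA, g, hg, rfl⟩⟩
    · exact ⟨φ, fun h => absurd h hφ⟩
  choose r hr using hr
  refine ⟨r '' Φ, hΦ.image r, fun e he => ?_⟩
  obtain ⟨g, hg, φ, hφ, rfl⟩ := h e he
  obtain ⟨hrA, g', hg', hr'⟩ := hr φ ⟨g, hg, he⟩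
  have hφ' : φ = g'⁻¹ • r φ := by rw [← hr', inv_smul_smul]
  have key : (g * g'⁻¹) • r φ = g • φ := by rw [mul_smul, ← hφ']
  refine ⟨g * g'⁻¹, ⟨G.mul_mem hg (G.inv_mem hg'), ?_⟩, _, ⟨φ, hφ, rfl⟩, key⟩
  have h1 := hA _ he
  rwa [← key, endpt_smul, hA _ hrA] at h1

/-- The first edge of a geodesic is unique. -/
theorem first_edge_unique {v x : X} {e e' : E} {b b' : Bool} (he : t.endpt e (!b) = v)
    (hx : x ∈ t.side e b) (he' : t.endpt e' (!b') = v) (hx' : x ∈ t.side e' b') : e = e' := by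
  by_contra hne
  have hv : v ∉ t.side e b := by rw [← he]; exact t.endpt_not_notMem _ _
  have hv' : v ∉ t.side e' b' := by rw [← he']; exact t.endpt_not_notMem _ _
  rcases t.side_trichotomy hv hv' with h | h | h
  · exact Set.disjoint_left.1 h hx hx'
  · rw [← he, t.endpt_mem_side_iff hne b' _ b] at hv'
    exact hv' (h (t.endpt_mem _ _))
  · rw [← he', t.endpt_mem_side_iff (Ne.symm hne) b _ b'] at hv
    exact hv (h (t.endpt_mem _ _))

/-- If a finitely generated group acts on a tree with finitely generated edge stabilizers, its
vertex stabilizers are finitely generated. Choose a finitely generated subgroup `K` of the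
stabilizer of `v` containing the stabilizers of representatives of the edges at `v` that matter, and
the finitely many elements describing the turns which the geodesics from `v` to `s • v`, with `s` a
generator, make at translates of `v`. Then by induction on word length the geodesic from `v` to
`g • v` leaves `v` through a `K`-translate of a representative, and `g` lies in `K` if it
fixes `v`. -/
theorem fg_inf_stabilizer (t : TreeAction Γ X E) {G : Subgroup Γ} (hG : G.FG) (v : X)
    (hE : ∀ e : E, (G ⊓ MulAction.stabilizer Γ v ⊓ MulAction.stabilizer Γ e).FG) :
    (G ⊓ MulAction.stabilizer Γ v).FG := by
  classical
  by_cases hfix : ∀ g ∈ G, g • v = v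
  · rwa [inf_eq_left.2 (fun g hg => hfix g hg)]
  push Not at hfix
  obtain ⟨g₀, hg₀, hg₀v⟩ := hfix
  have hEne : Nonempty E := ⟨(t.exists_endpt_eq_of_ne hg₀v).choose⟩
  set H := G ⊓ MulAction.stabilizer Γ v with hH
  -- The first edge of the geodesic from `v` to `x`.
  have hed : ∀ x : X, ∃ e : E, x ≠ v → ∃ b, t.endpt e (!b) = v ∧ x ∈ t.side e b := by
    intro x
    by_cases hx : x = v
    · exact ⟨Classical.arbitrary E, fun h => absurd hx h⟩
    · obtain ⟨e, b, h⟩ := t.exists_endpt_eq_of_ne (Ne.symm hx)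
      exact ⟨e, fun _ => ⟨b, h⟩⟩
  choose ed hed using hed
  have hed_smul : ∀ a ∈ H, ∀ x, x ≠ v → ed (a • x) = a • ed x := by
    intro a ha x hx
    have hav : a • v = v := ha.2
    have hax : a • x ≠ v := by
      intro h; rw [← hav] at h; exact hx (smul_left_cancel _ h)
    obtain ⟨b, h1, h2⟩ := hed _ hax
    obtain ⟨b', h3, h4⟩ := hed _ hx
    exact first_edge_unique h1 h2 (b' := b') (by rw [endpt_smul, h3, hav])
      ((t.smul_mem_side a).2 h4)
  set A : Set E := {e | ∃ g ∈ G, g • v ≠ v ∧ e = ed (g • v)} with hA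
  have hAfin : FiniteOrbitsOn H A := by
    have hQ : FiniteOrbitsOn G {x | ∃ g ∈ G, g • v = x} :=
      ⟨{v}, Set.finite_singleton _, fun x ⟨g, hg, h⟩ => ⟨g, hg, v, rfl, h⟩⟩
    have hull := finiteOrbitsOn_hull (t := t) hG hQ
    have hsub : A ⊆ t.hull {x | ∃ g ∈ G, g • v = x} := by
      rintro _ ⟨g, hg, hgv, rfl⟩
      obtain ⟨b, h1, h2⟩ := hed _ hgv
      exact ⟨v, ⟨1, G.one_mem, one_smul _ _⟩, _, ⟨g, hg, rfl⟩,
        t.mem_sep_of_side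
          (fun h => t.endpt_not_notMem (ed (g • v)) b (by rw [h1]; exact h)) h2⟩
    have hb : ∀ b, FiniteOrbitsOn H {e ∈ A | t.endpt e b = v} := fun b =>
      finiteOrbitsOn_stabilizer b (fun e he => he.2)
        (hull.mono (fun e he => hsub he.1))
    refine ((hb true).union (hb false)).mono ?_
    rintro _ ⟨g, hg, hgv, rfl⟩
    obtain ⟨b, h1, h2⟩ := hed _ hgv
    cases b
    · exact .inl ⟨⟨g, hg, hgv, rfl⟩, h1⟩
    · exact .inr ⟨⟨g, hg, hgv, rfl⟩, h1⟩
  obtain ⟨Φ, hΦ, hAΦ⟩ := hAfin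
  -- Representatives of the `H`-orbits of edges.
  obtain ⟨rep, hrep, hrep_smul⟩ : ∃ rep : E → E, (∀ e, ∃ a ∈ H, e = a • rep e) ∧
      ∀ a ∈ H, ∀ e, rep (a • e) = rep e := by
    refine ⟨fun e => (Quotient.out (Quotient.mk (MulAction.orbitRel H E) e)), fun e => ?_,
      fun a ha e => ?_⟩
    · obtain ⟨a, ha⟩ := MulAction.orbitRel_apply.1 ((MulAction.orbitRel H E).symm'
        (Quotient.exact (Quotient.out_eq (Quotient.mk (MulAction.orbitRel H E) e))))
      exact ⟨a, a.2, ha.symm⟩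
    · exact congrArg Quotient.out (Quotient.sound (s := MulAction.orbitRel H E)
        (MulAction.orbitRel_apply.2 ⟨⟨a, ha⟩, rfl⟩))
  -- The element `α e` of `H` moves the representative of the orbit of `e` to `e`.
  choose α hαH hα using hrep
  obtain ⟨S, hS⟩ := hG
  -- An element of `G`, depending only on the vertex `g • v`, that moves `v` to it.
  obtain ⟨hh, hhG⟩ : ∃ hh : X → Γ, ∀ g ∈ G, hh (g • v) ∈ G ∧ hh (g • v) • v = g • v := by
    have : ∀ x : X, ∃ h : Γ, (∃ g ∈ G, g • v = x) → h ∈ G ∧ h • v = x := by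
      intro x
      by_cases hx : ∃ g ∈ G, g • v = x
      · obtain ⟨g, hg⟩ := hx
        exact ⟨g, fun _ => hg⟩
      · exact ⟨1, fun h => absurd h hx⟩
    choose hh hhx using this
    exact ⟨hh, fun g hg => hhx _ ⟨g, hg, rfl⟩⟩
  choose gens hgens using fun e => hE e
  set S' : Set Γ := S ∪ (S : Set Γ)⁻¹ with hS'
  have hS'f : S'.Finite := S.finite_toSet.union S.finite_toSet.inv
  have hS'inv : ∀ s ∈ S', s⁻¹ ∈ S' := by
    rintro s (hs | hs)
    · exact .inr (by simpa using hs)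
    · exact .inl hs
  have hS'G : ∀ s ∈ S', s ∈ G := by
    have hSG : ∀ s ∈ S, s ∈ G := fun s hs => by rw [← hS]; exact Subgroup.subset_closure hs
    rintro s (hs | hs)
    · exact hSG s hs
    · simpa using G.inv_mem (hSG _ hs)
  -- Generators of edge stabilizers, generators of `G`, first edges of their geodesics, and turns.
  set T : Set Γ := (⋃ φ ∈ Φ, (gens (rep φ) : Set Γ)) ∪ S' ∪ ((fun s => α (ed (s • v))) '' S') ∪
    ⋃ s ∈ S', ⋃ e ∈ t.sep v (s • v), Set.range fun b : Bool =>
      (α (ed ((hh (t.endpt e b))⁻¹ • v)))⁻¹ * α (ed ((hh (t.endpt e b))⁻¹ • s • v)) with hT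
  have hTf : T.Finite := by
    refine Set.Finite.union (Set.Finite.union (Set.Finite.union ?_ hS'f) (hS'f.image _)) ?_
    · exact hΦ.biUnion fun φ _ => (gens _).finite_toSet
    · exact hS'f.biUnion fun s _ => (t.sep_finite _ _).biUnion fun e _ => Set.finite_range _
  set K : Subgroup Γ := Subgroup.closure (T ∩ H) with hK
  have hKH : K ≤ H := (Subgroup.closure_le _).2 Set.inter_subset_right
  have hTK : ∀ x ∈ T, x ∈ H → x ∈ K := fun x h1 h2 => Subgroup.subset_closure ⟨h1, h2⟩
  suffices hHK : H ≤ K by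
    rw [le_antisymm hHK hKH]
    exact ⟨(hTf.subset (Set.inter_subset_left (t := (H : Set Γ)))).toFinset,
      by rw [Set.Finite.coe_toFinset]⟩
  have hstab : ∀ e ∈ A, ∀ a ∈ H, a • rep e = rep e → a ∈ K := by
    intro e he a ha hae
    obtain ⟨g, hg, φ, hφ, rfl⟩ := hAΦ e he
    rw [hrep_smul g hg] at hae
    have h1 : a ∈ H ⊓ MulAction.stabilizer Γ (rep φ) := ⟨ha, hae⟩
    rw [← hgens] at h1
    refine (Subgroup.closure_le _).2 (fun x hx => ?_) h1
    refine hTK x (.inl (.inl (.inl (Set.mem_biUnion hφ hx)))) ?_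
    have h2 : x ∈ H ⊓ MulAction.stabilizer Γ (rep φ) := by
      rw [← hgens]; exact Subgroup.subset_closure hx
    exact h2.1
  have hαK : ∀ e ∈ A, ∀ a ∈ H, (α (a • e) ∈ K ↔ a * α e ∈ K) := by
    intro e he a ha
    have h1 : (α (a • e))⁻¹ * (a * α e) ∈ K := by
      refine hstab e he _ (H.mul_mem (H.inv_mem (hαH _)) (H.mul_mem ha (hαH _))) ?_
      have h2 := hα (a • e)
      rw [hrep_smul a ha] at h2
      rw [mul_smul, mul_smul, ← hα e, inv_smul_eq_iff]
      exact h2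
    constructor
    · intro h; simpa using K.mul_mem h h1
    · intro h; simpa [mul_assoc] using K.mul_mem h (K.inv_mem h1)
  -- If `g • v = v`, then `g` lies in `K`; otherwise the geodesic from `v` to `g • v` leaves `v`
  -- through a `K`-translate of a representative. This passes from `g` to `g * s`: the first edge
  -- changes only if the geodesic from `g • v` to `(g * s) • v` passes through `v`.
  have step : ∀ g ∈ G, ∀ s ∈ S', ((g • v = v → g ∈ K) ∧ (g • v ≠ v → α (ed (g • v)) ∈ K)) →
      (((g * s) • v = v → g * s ∈ K) ∧ ((g * s) • v ≠ v → α (ed ((g * s) • v)) ∈ K)) := by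
    intro g hg s hs hgc
    have hsG := hS'G s hs
    have hsα : ∀ s ∈ S', α (ed (s • v)) ∈ K := fun s hs => hTK _ (.inl (.inr ⟨s, hs, rfl⟩)) (hαH _)
    by_cases hgv : g • v = v
    · have hgK := hgc.1 hgv
      by_cases hsv : s • v = v
      · have hsK : s ∈ K := hTK s (.inl (.inl (.inr hs))) ⟨hsG, hsv⟩
        exact ⟨fun _ => K.mul_mem hgK hsK, fun h => absurd (by rw [mul_smul, hsv, hgv]) h⟩
      · refine ⟨fun h => absurd ?_ hsv, fun _ => ?_⟩
        · rw [mul_smul] at h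
          exact smul_left_cancel g (h.trans hgv.symm)
        · rw [mul_smul, hed_smul g (hKH hgK) _ hsv, hαK _ ⟨s, hsG, hsv, rfl⟩ _ (hKH hgK)]
          exact K.mul_mem hgK (hsα s hs)
    have hgK := hgc.2 hgv
    refine ⟨fun h => ?_, fun h => ?_⟩
    · have hH1 : g * s ∈ H := ⟨G.mul_mem hg hsG, h⟩
      have hs' : s⁻¹ • v ≠ v := by
        intro h'
        rw [inv_smul_eq_iff] at h'
        rw [mul_smul, ← h'] at h
        exact hgv h
      have e1 : g • v = (g * s) • s⁻¹ • v := by rw [mul_smul, smul_inv_smul]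
      rw [e1, hed_smul _ hH1 _ hs', hαK _ ⟨s⁻¹, G.inv_mem hsG, hs', rfl⟩ _ hH1] at hgK
      exact (K.mul_mem_cancel_right (hsα _ (hS'inv s hs))).1 hgK
    · by_cases heq : ed (g • v) = ed ((g * s) • v)
      · rwa [← heq]
      obtain ⟨hwG, hwv⟩ := hhG g⁻¹ (G.inv_mem hg)
      set w := hh (g⁻¹ • v) with hw
      have haH : g * w ∈ H := ⟨G.mul_mem hg hwG, by
        change (g * w) • v = v
        rw [mul_smul, hwv, smul_inv_smul]⟩
      have ep : g • v = (g * w) • w⁻¹ • v := by rw [mul_smul, smul_inv_smul]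
      have eq : (g * s) • v = (g * w) • w⁻¹ • s • v := by
        rw [mul_smul, mul_smul, smul_inv_smul]
      have hp : w⁻¹ • v ≠ v := by
        intro h'; rw [h'] at ep; exact hgv (ep.trans haH.2)
      have hq : w⁻¹ • s • v ≠ v := by
        intro h'; rw [h'] at eq; exact h (eq.trans haH.2)
      have hpA : ed (w⁻¹ • v) ∈ A := ⟨w⁻¹, G.inv_mem hwG, hp, rfl⟩
      have hqA : ed (w⁻¹ • s • v) ∈ A :=
        ⟨w⁻¹ * s, G.mul_mem (G.inv_mem hwG) hsG, by rwa [mul_smul], by rw [mul_smul]⟩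
      rw [ep, eq, hed_smul _ haH _ hp, hed_smul _ haH _ hq] at heq
      have hne : ed (w⁻¹ • v) ≠ ed (w⁻¹ • s • v) := fun h' => heq (by rw [h'])
      rw [ep, hed_smul _ haH _ hp, hαK _ hpA _ haH] at hgK
      rw [eq, hed_smul _ haH _ hq, hαK _ hqA _ haH]
      obtain ⟨b, h1, h2⟩ := hed _ hp
      obtain ⟨b', h3, h4⟩ := hed _ hq
      have hsep : w • ed (w⁻¹ • v) ∈ t.sep v (s • v) := by
        have : w • ed (w⁻¹ • v) ∈ t.sep (w • w⁻¹ • v) (w • w⁻¹ • s • v) := by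
          rw [smul_mem_sep, sep_comm]
          exact t.mem_sep_of_side (fun h5 => hne (first_edge_unique h1 h5 h3 h4)) h2
        simpa using this
      have hturn : (α (ed (w⁻¹ • v)))⁻¹ * α (ed (w⁻¹ • s • v)) ∈ K := by
        refine hTK _ (.inr (Set.mem_biUnion hs (Set.mem_biUnion hsep ⟨!b, ?_⟩)))
          (H.mul_mem (H.inv_mem (hαH _)) (hαH _))
        have : t.endpt (w • ed (w⁻¹ • v)) (!b) = g⁻¹ • v := by
          rw [endpt_smul, h1, hwv]
        simp only [this, ← hw]
      have := K.mul_mem hgK hturn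
      rwa [← mul_assoc, mul_inv_cancel_right] at this
  have main : ∀ g ∈ G, (g • v = v → g ∈ K) ∧ (g • v ≠ v → α (ed (g • v)) ∈ K) := by
    intro g hg
    rw [← hS] at hg
    induction hg using Subgroup.closure_induction_right with
    | one => exact ⟨fun _ => K.one_mem, fun h => absurd (one_smul _ _) h⟩
    | mul_right x hx y hy ih => exact step x (by rwa [← hS]) y (.inl hy) ih
    | mul_inv_cancel x hx y hy ih =>
      exact step x (by rwa [← hS]) y⁻¹ (.inr (by simpa using hy)) ih
  exact fun g hg => (main g hg.1).1 hg.2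

end VertexStabilizer

end TreeAction

/-! ### Trees of cosets -/

section Trivialization

/-- A labelling of the edges of a tree by elements of a group is a coboundary. -/
theorem IsMultigraphTree.exists_potential {V E H : Type*} [Group H] {src tgt : E → V}
    (h : IsMultigraphTree src tgt) (b : E → H) :
    ∃ f : V → H, ∀ e, f (tgt e) = f (src e) * b e := by
  classical
  set G := underlyingGraph src tgt with hG
  have htree : G.IsTree := h.isTree
  have hadj : ∀ e, G.Adj (src e) (tgt e) := by
    intro e
    rw [hG, underlyingGraph, SimpleGraph.fromRel_adj]
    exact ⟨h.no_loops e, .inl ⟨e, rfl, rfl⟩⟩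
  obtain ⟨l, hl1, hl2⟩ : ∃ l : V → V → H, (∀ e, l (src e) (tgt e) = b e) ∧
      ∀ e, l (tgt e) (src e) = (b e)⁻¹ := by
    refine ⟨fun u v => if h : ∃ e, src e = u ∧ tgt e = v then b h.choose else
      if h : ∃ e, tgt e = u ∧ src e = v then (b h.choose)⁻¹ else 1, fun e => ?_, fun e => ?_⟩
    · have hex : ∃ e', src e' = src e ∧ tgt e' = tgt e := ⟨e, rfl, rfl⟩
      have h1 := hex.choose_spec
      have : hex.choose = e := h.no_multiple_edges (by simp only [h1])
      beta_reduce
      rw [dif_pos hex, this]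
    · have hnex : ¬ ∃ e', src e' = tgt e ∧ tgt e' = src e := by
        rintro ⟨e', h1, h2⟩
        have : e' = e := h.no_multiple_edges (by simp only [h1, h2, Sym2.eq_swap])
        subst this
        exact h.no_loops e' h1
      have hex : ∃ e', tgt e' = tgt e ∧ src e' = src e := ⟨e, rfl, rfl⟩
      have h1 := hex.choose_spec
      have : hex.choose = e := h.no_multiple_edges (by simp only [h1])
      beta_reduce
      rw [dif_neg hnex, dif_pos hex, this]
  let w : ∀ {u v : V}, G.Walk u v → H := fun p => (p.darts.map fun d => l d.fst d.snd).prod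
  obtain ⟨r⟩ := htree.connected.nonempty
  have hex : ∀ v, ∃ p : G.Walk r v, p.IsPath := fun v =>
    ⟨(htree.connected r v).some.bypass, SimpleGraph.Walk.bypass_isPath _⟩
  choose p hp using hex
  have hconcat : ∀ {u v : V} (hadj : G.Adj u v), p v = (p u).concat hadj →
      w (p v) = w (p u) * l u v := by
    intro u v hadj h1
    simp only [w, h1, SimpleGraph.Walk.darts_concat]
    simp
  refine ⟨fun v => w (p v), fun e => ?_⟩
  beta_reduce
  by_cases hv : src e ∈ (p (tgt e)).support
  · rw [hconcat (hadj e) (htree.isAcyclic.path_concat (hp _) (hp _) (hadj e) hv), hl1]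
  · have hv' := htree.isAcyclic.mem_support_of_ne_mem_support_of_adj_of_isPath (hp _) (hp _)
      (hadj e) hv
    rw [hconcat (hadj e).symm (htree.isAcyclic.path_concat (hp _) (hp _) (hadj e).symm hv'), hl2,
      inv_mul_cancel_right]

end Trivialization

section CosetTree

variable {π V E : Type*} [Group π] (src tgt : E → V) (A : V → Subgroup π) (B : E → Subgroup π)
  (t : E → π)

/-- The data from which the coset graph with vertices `g A_v` and edges `g B_e`, where `g B_e` runs
from `g A_{src e}` to `g t_e A_{tgt e}`, is shown to be a tree. The homomorphism `Φ` encodes a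
cocycle of `π` with values in the functions on the edges modulo two; the resulting vertex potential
changes by exactly the indicator function of an edge when this edge is crossed, so every edge
separates its two ends. -/
structure CosetTreeData where
  src_le : ∀ e, B e ≤ A (src e)
  tgt_mem : ∀ e, ∀ b ∈ B e, (t e)⁻¹ * b * t e ∈ A (tgt e)
  Φ : π →* ((Σ e, π ⧸ B e) → Multiplicative (ZMod 2)) ⋊[mulAutArrow] π
  Φ_right : ∀ g, (Φ g).right = g
  pot : V → (Σ e, π ⧸ B e) → Multiplicative (ZMod 2)
  Φ_vertex : ∀ v, ∀ h ∈ A v, Φ h * SemidirectProduct.inl (pot v) =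
    SemidirectProduct.inl (pot v) * SemidirectProduct.inr h
  Φ_letter : ∀ e, ∃ δ : (Σ e, π ⧸ B e) → Multiplicative (ZMod 2),
    δ ⟨e, ((1 : π) : π ⧸ B e)⟩ ≠ 1 ∧ (∀ ε, ε ≠ ⟨e, ((1 : π) : π ⧸ B e)⟩ → δ ε = 1) ∧
    Φ (t e) * SemidirectProduct.inl (pot (tgt e)) =
      SemidirectProduct.inl (pot (src e)) * SemidirectProduct.inl δ * SemidirectProduct.inr (t e)
  connected : ∀ P : (Σ v, π ⧸ A v) → Prop,
    (∀ e (g : π), P ⟨src e, (g : π ⧸ A (src e))⟩ ↔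
      P ⟨tgt e, ((g * t e : π) : π ⧸ A (tgt e))⟩) → ∀ x y, P x → P y

namespace CosetTreeData

variable {src tgt A B t} (c : CosetTreeData src tgt A B t)

/-- The vertex `g A_{src e}` of the edge `g B_e`. -/
def edgeSrc (ε : Σ e, π ⧸ B e) : Σ v, π ⧸ A v :=
  ⟨src ε.1, Quotient.liftOn' ε.2 (fun g => (g : π ⧸ A (src ε.1))) fun a b h => by
    rw [QuotientGroup.leftRel_apply] at h
    exact QuotientGroup.eq.2 (c.src_le _ h)⟩

/-- The vertex `g t_e A_{tgt e}` of the edge `g B_e`. -/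
def edgeTgt (ε : Σ e, π ⧸ B e) : Σ v, π ⧸ A v :=
  ⟨tgt ε.1, Quotient.liftOn' ε.2 (fun g => ((g * t ε.1 : π) : π ⧸ A (tgt ε.1))) fun a b h => by
    rw [QuotientGroup.leftRel_apply] at h
    have := c.tgt_mem _ _ h
    refine QuotientGroup.eq.2 ?_
    convert this using 1
    group⟩

/-- The potential of a vertex, as a function on the edges. -/
def D (x : Σ v, π ⧸ A v) : (Σ e, π ⧸ B e) → Multiplicative (ZMod 2) :=
  Quotient.liftOn' x.2 (fun g => (c.Φ g * SemidirectProduct.inl (c.pot x.1)).left) fun a b h => by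
    rw [QuotientGroup.leftRel_apply] at h
    obtain ⟨k, hk, rfl⟩ : ∃ k ∈ A x.1, b = a * k := ⟨_, h, by group⟩
    rw [map_mul, mul_assoc, c.Φ_vertex _ k hk, ← mul_assoc]
    simp

theorem D_mk (v : V) (g : π) :
    c.D ⟨v, (g : π ⧸ A v)⟩ = (c.Φ g).left * mulAutArrow g (c.pot v) := by
  change (c.Φ g * SemidirectProduct.inl (c.pot v)).left = _
  simp [c.Φ_right]

theorem D_smul (γ : π) (x : Σ v, π ⧸ A v) :
    c.D (γ • x) = (c.Φ γ).left * mulAutArrow γ (c.D x) := by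
  obtain ⟨v, q⟩ := x
  induction q using QuotientGroup.induction_on with
  | H g =>
    change c.D ⟨v, ((γ * g : π) : π ⧸ A v)⟩ = _
    rw [D_mk, D_mk, map_mul, map_mul, SemidirectProduct.mul_left, c.Φ_right, map_mul]
    rw [MulAut.mul_apply, mul_assoc]

theorem D_tgt_one (e : E) (ε : Σ e, π ⧸ B e) :
    c.D (c.edgeTgt ⟨e, ((1 : π) : π ⧸ B e)⟩) ε = c.D (c.edgeSrc ⟨e, ((1 : π) : π ⧸ B e)⟩) ε ↔
      ε ≠ ⟨e, ((1 : π) : π ⧸ B e)⟩ := by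
  obtain ⟨δ, h1, h2, h3⟩ := c.Φ_letter e
  have h4 : c.D (c.edgeTgt ⟨e, ((1 : π) : π ⧸ B e)⟩) =
      c.D (c.edgeSrc ⟨e, ((1 : π) : π ⧸ B e)⟩) * δ := by
    change c.D ⟨tgt e, ((1 * t e : π) : π ⧸ A (tgt e))⟩ = c.D ⟨src e, ((1 : π) : π ⧸ A (src e))⟩ * δ
    rw [D_mk, D_mk, one_mul]
    have := congrArg SemidirectProduct.left h3
    simp only [SemidirectProduct.mul_left, c.Φ_right, SemidirectProduct.left_inl,
      SemidirectProduct.right_inl, map_one, SemidirectProduct.left_inr, MulAut.one_apply,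
      mul_one] at this
    rw [this]
    simp
  rw [h4, Pi.mul_apply, mul_eq_left]
  constructor
  · rintro h rfl; exact h1 h
  · exact h2 ε

theorem edgeSrc_smul (g : π) (ε : Σ e, π ⧸ B e) : c.edgeSrc (g • ε) = g • c.edgeSrc ε := by
  obtain ⟨e, q⟩ := ε
  induction q using QuotientGroup.induction_on with
  | H a => rfl

theorem edgeTgt_smul (g : π) (ε : Σ e, π ⧸ B e) : c.edgeTgt (g • ε) = g • c.edgeTgt ε := by
  obtain ⟨e, q⟩ := ε
  induction q using QuotientGroup.induction_on with
  | H a =>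
    change (⟨tgt e, ((g * a * t e : π) : π ⧸ A (tgt e))⟩ : Σ v, π ⧸ A v) =
      ⟨tgt e, ((g * (a * t e) : π) : π ⧸ A (tgt e))⟩
    rw [mul_assoc]

theorem D_smul_eq_iff (g : π) (x y : Σ v, π ⧸ A v) (ε : Σ e, π ⧸ B e) :
    c.D (g • x) (g • ε) = c.D (g • y) (g • ε) ↔ c.D x ε = c.D y ε := by
  have h : ∀ F : (Σ e, π ⧸ B e) → Multiplicative (ZMod 2), mulAutArrow g F (g • ε) = F ε := by
    intro F
    change F (g⁻¹ • g • ε) = F ε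
    rw [inv_smul_smul]
  rw [D_smul, D_smul, Pi.mul_apply, Pi.mul_apply, h, h, mul_right_inj]

theorem D_tgt_eq_iff (ε ε' : Σ e, π ⧸ B e) :
    c.D (c.edgeTgt ε) ε' = c.D (c.edgeSrc ε) ε' ↔ ε' ≠ ε := by
  obtain ⟨e, q⟩ := ε
  induction q using QuotientGroup.induction_on with
  | H g =>
    have h : (⟨e, (g : π ⧸ B e)⟩ : Σ e, π ⧸ B e) = g • ⟨e, ((1 : π) : π ⧸ B e)⟩ := by
      change _ = (⟨e, ((g * 1 : π) : π ⧸ B e)⟩ : Σ e, π ⧸ B e)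
      rw [mul_one]
    rw [h, edgeSrc_smul, edgeTgt_smul, ← smul_inv_smul g ε', D_smul_eq_iff, D_tgt_one, ne_eq,
      ne_eq, smul_left_cancel_iff]

/-- The action on the tree of cosets. -/
def treeAction : TreeAction π (Σ v, π ⧸ A v) (Σ e, π ⧸ B e) where
  src := c.edgeSrc
  tgt := c.edgeTgt
  src_smul := c.edgeSrc_smul
  tgt_smul := c.edgeTgt_smul
  pos ε := {x | c.D x ε = c.D (c.edgeTgt ε) ε}
  smul_mem_pos g ε x := by
    change c.D (g • x) (g • ε) = c.D (c.edgeTgt (g • ε)) (g • ε) ↔ _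
    rw [edgeTgt_smul, D_smul_eq_iff]; rfl
  src_notMem ε h := (c.D_tgt_eq_iff ε ε).1 (Eq.symm h) rfl
  tgt_mem _ := rfl
  pos_iff ε ε' h := by
    change c.D _ _ = _ ↔ c.D _ _ = _
    rw [(c.D_tgt_eq_iff ε' ε).2 h.symm]
  connected P hP := c.connected P fun e g => hP ⟨e, (g : π ⧸ B e)⟩

end CosetTreeData

end CosetTree

/-! ### Fundamental groups and Bass–Serre trees of graphs of groups -/

namespace GraphOfGroups

variable (𝒢 : GraphOfGroups.{u}) (T : Set 𝒢.E)

theorem letter_mul_vertexHom (e : 𝒢.E) (a : 𝒢.edgeGroup e) :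
    𝒢.letter T e * 𝒢.vertexHom T _ (𝒢.tgtHom e a) * (𝒢.letter T e)⁻¹ =
      𝒢.vertexHom T _ (𝒢.srcHom e a) := by
  rw [← mul_inv_eq_one]
  refine (QuotientGroup.eq_one_iff (𝒢.preLetter e * 𝒢.preVertex _ (𝒢.tgtHom e a) *
    (𝒢.preLetter e)⁻¹ * (𝒢.preVertex _ (𝒢.srcHom e a))⁻¹)).2 ?_
  exact Subgroup.subset_normalClosure (.inl ⟨e, a, rfl⟩)

theorem letter_eq_one {e : 𝒢.E} (he : e ∈ T) : 𝒢.letter T e = 1 :=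
  (QuotientGroup.eq_one_iff _).2 (Subgroup.subset_normalClosure (.inr ⟨e, he, rfl⟩))

/-- The universal property of the fundamental group. -/
theorem exists_hom {H : Type*} [Group H] (ρ : ∀ v, 𝒢.vertexGroup v →* H) (c : 𝒢.E → H)
    (h₁ : ∀ e a, c e * ρ _ (𝒢.tgtHom e a) * (c e)⁻¹ = ρ _ (𝒢.srcHom e a))
    (h₂ : ∀ e ∈ T, c e = 1) :
    ∃ Φ : 𝒢.FundamentalGroup T →* H, (∀ v g, Φ (𝒢.vertexHom T v g) = ρ v g) ∧
      ∀ e, Φ (𝒢.letter T e) = c e := by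
  let F : 𝒢.PathGroup →* H := Monoid.Coprod.lift (Monoid.CoprodI.lift ρ) (FreeGroup.lift c)
  have hv : ∀ v g, F (𝒢.preVertex v g) = ρ v g := by
    intro v g
    simp [F, preVertex]
  have hl : ∀ e, F (𝒢.preLetter e) = c e := by
    intro e
    simp [F, preLetter]
  have hle : Subgroup.normalClosure (𝒢.relators T) ≤ F.ker := by
    refine Subgroup.normalClosure_le_normal ?_
    rintro _ (⟨e, a, rfl⟩ | ⟨e, he, rfl⟩)
    · change F _ = 1
      rw [map_mul, map_mul, map_mul, map_inv, map_inv, hl, hv, hv, h₁, mul_inv_cancel]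
    · change F _ = 1
      rw [hl, h₂ e he]
  exact ⟨QuotientGroup.lift _ F hle, hv, hl⟩

/-- The fundamental group is generated by the vertex groups and the stable letters. -/
theorem eq_top_of_mem {K : Subgroup (𝒢.FundamentalGroup T)} (hv : ∀ v g, 𝒢.vertexHom T v g ∈ K)
    (hl : ∀ e, 𝒢.letter T e ∈ K) : K = ⊤ := by
  rw [eq_top_iff]
  rintro g -
  induction g using QuotientGroup.induction_on with
  | H x =>
    induction x using Monoid.Coprod.induction_on with
    | inl m =>
      induction m using Monoid.CoprodI.induction_on with
      | one => rw [map_one]; exact K.one_mem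
      | of i m => exact hv i m
      | mul x y hx hy => rw [map_mul]; exact K.mul_mem hx hy
    | inr n =>
      induction n using FreeGroup.induction_on with
      | C1 => rw [map_one]; exact K.one_mem
      | of x => exact hl x
      | inv_of x hx => rw [map_inv]; exact K.inv_mem hx
      | mul x y hx hy => rw [map_mul]; exact K.mul_mem hx hy
    | mul x y hx hy => exact K.mul_mem hx hy

/-- The stabilizer of the base edge over `e` of the Bass–Serre tree. -/
abbrev edgeSubgroup (e : 𝒢.E) : Subgroup (𝒢.FundamentalGroup T) :=
  ((𝒢.vertexHom T (𝒢.src e)).comp (𝒢.srcHom e)).range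

theorem hom_ext {H : Type*} [Group H] {f f' : 𝒢.FundamentalGroup T →* H}
    (hv : ∀ v g, f (𝒢.vertexHom T v g) = f' (𝒢.vertexHom T v g))
    (hl : ∀ e, f (𝒢.letter T e) = f' (𝒢.letter T e)) : f = f' := by
  have h : f.eqLocus f' = ⊤ := 𝒢.eq_top_of_mem T hv hl
  refine MonoidHom.ext fun g => ?_
  have : g ∈ f.eqLocus f' := h ▸ Subgroup.mem_top g
  exact this

/-- Two vertices of the Bass–Serre tree lie in the same class of every equivalence relation
identifying the two ends of each edge. -/
theorem bassSerre_connected (hT : 𝒢.IsMaximalTree T) (P : 𝒢.BassSerreVertex T → Prop)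
    (hP : ∀ e (g : 𝒢.FundamentalGroup T), P ⟨𝒢.src e, (g : 𝒢.FundamentalGroup T ⧸ _)⟩ ↔
      P ⟨𝒢.tgt e, ((g * 𝒢.letter T e : 𝒢.FundamentalGroup T) : 𝒢.FundamentalGroup T ⧸ _)⟩)
    (x y : 𝒢.BassSerreVertex T) (hx : P x) : P y := by
  have h1 : ∀ (g : 𝒢.FundamentalGroup T) (v w : 𝒢.V),
      P ⟨v, (g : 𝒢.FundamentalGroup T ⧸ _)⟩ → P ⟨w, (g : 𝒢.FundamentalGroup T ⧸ _)⟩ := by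
    intro g v w hv
    obtain ⟨p⟩ := hT.isTree.connected v w
    induction p with
    | nil => exact hv
    | cons hadj p ih =>
      refine ih ?_
      rw [underlyingGraph, SimpleGraph.fromRel_adj] at hadj
      obtain ⟨-, ⟨⟨e, he⟩, h1, h2⟩ | ⟨⟨e, he⟩, h1, h2⟩⟩ := hadj
      · have := hP e g
        rw [𝒢.letter_eq_one T he, mul_one] at this
        subst h1 h2
        exact this.1 hv
      · have := hP e g
        rw [𝒢.letter_eq_one T he, mul_one] at this
        subst h1 h2
        exact this.2 hv
  have h2 : ∀ (k g : 𝒢.FundamentalGroup T) (v : 𝒢.V),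
      P ⟨v, (g : 𝒢.FundamentalGroup T ⧸ _)⟩ ↔
        P ⟨v, ((g * k : 𝒢.FundamentalGroup T) : 𝒢.FundamentalGroup T ⧸ _)⟩ := by
    let K : Subgroup (𝒢.FundamentalGroup T) :=
      { carrier := {k | ∀ (g : 𝒢.FundamentalGroup T) (v : 𝒢.V),
          P ⟨v, (g : 𝒢.FundamentalGroup T ⧸ _)⟩ ↔
            P ⟨v, ((g * k : 𝒢.FundamentalGroup T) : 𝒢.FundamentalGroup T ⧸ _)⟩}
        mul_mem' := by
          intro a b ha hb g v
          rw [← mul_assoc]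
          exact (ha g v).trans (hb _ v)
        one_mem' := by intro g v; rw [mul_one]
        inv_mem' := by
          intro a ha g v
          have := ha (g * a⁻¹) v
          rw [inv_mul_cancel_right] at this
          exact this.symm }
    have hK : K = ⊤ := by
      refine 𝒢.eq_top_of_mem T (fun w a g v => ?_) (fun e g v => ?_)
      · have : (⟨w, (g : 𝒢.FundamentalGroup T ⧸ _)⟩ : 𝒢.BassSerreVertex T) =
            ⟨w, ((g * 𝒢.vertexHom T w a : 𝒢.FundamentalGroup T) : 𝒢.FundamentalGroup T ⧸ _)⟩ := by
          rw [Sigma.mk.injEq]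
          refine ⟨rfl, heq_of_eq (QuotientGroup.eq.2 ?_)⟩
          rw [inv_mul_cancel_left]
          exact ⟨a, rfl⟩
        constructor
        · intro h; exact h1 _ w v (this ▸ h1 _ v w h)
        · intro h
          have h' := h1 _ v w h
          rw [← this] at h'
          exact h1 _ w v h'
      · constructor
        · intro h; exact h1 _ _ v ((hP e g).1 (h1 _ v _ h))
        · intro h; exact h1 _ _ v ((hP e g).2 (h1 _ v _ h))
    intro k
    have : k ∈ K := hK ▸ Subgroup.mem_top k
    exact this
  obtain ⟨v, q⟩ := x
  obtain ⟨w, r⟩ := y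
  induction q using QuotientGroup.induction_on with
  | H g =>
    induction r using QuotientGroup.induction_on with
    | H h =>
      have := (h2 (g⁻¹ * h) g v).1 hx
      rw [mul_inv_cancel_left] at this
      exact h1 _ v w this

/-- The Bass–Serre graph of a graph of groups is a tree. Potentials `p v` on the base vertices are
chosen so that they change by the indicator function `δ e` along the edges `e` of the maximal tree;
conjugating by them yields a homomorphism to the semidirect product. -/
theorem nonempty_cosetTreeData (hT : 𝒢.IsMaximalTree T) :
    Nonempty (CosetTreeData 𝒢.src 𝒢.tgt (fun v => (𝒢.vertexHom T v).range) (𝒢.edgeSubgroup T)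
      (𝒢.letter T)) := by
  classical
  let ε₀ : 𝒢.E → Σ e, 𝒢.FundamentalGroup T ⧸ 𝒢.edgeSubgroup T e :=
    fun e => ⟨e, ((1 : 𝒢.FundamentalGroup T) : 𝒢.FundamentalGroup T ⧸ _)⟩
  let δ : 𝒢.E → (Σ e, 𝒢.FundamentalGroup T ⧸ 𝒢.edgeSubgroup T e) → Multiplicative (ZMod 2) :=
    fun e => Pi.mulSingle (ε₀ e) (Multiplicative.ofAdd 1)
  have hδ : ∀ e (a : 𝒢.edgeGroup e),
      mulAutArrow (𝒢.vertexHom T _ (𝒢.srcHom e a)) (δ e) = δ e := by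
    intro e a
    have hfix : 𝒢.vertexHom T _ (𝒢.srcHom e a) • ε₀ e = ε₀ e := by
      change (⟨e, _⟩ : Σ e, 𝒢.FundamentalGroup T ⧸ 𝒢.edgeSubgroup T e) = ⟨e, _⟩
      rw [Sigma.mk.injEq]
      refine ⟨rfl, heq_of_eq (QuotientGroup.eq.2 ?_)⟩
      simp only [smul_eq_mul, mul_one]
      exact Subgroup.inv_mem _ ⟨a, rfl⟩
    funext ε
    change δ e ((𝒢.vertexHom T _ (𝒢.srcHom e a))⁻¹ • ε) = δ e ε
    simp only [δ, Pi.mulSingle_apply, inv_smul_eq_iff, hfix]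
  obtain ⟨p, hp⟩ := IsMultigraphTree.exists_potential hT (fun e => δ e)
  let i := SemidirectProduct.inl (φ := mulAutArrow (G := 𝒢.FundamentalGroup T)
    (A := Σ e, 𝒢.FundamentalGroup T ⧸ 𝒢.edgeSubgroup T e) (M := Multiplicative (ZMod 2)))
  let j := SemidirectProduct.inr (φ := mulAutArrow (G := 𝒢.FundamentalGroup T)
    (A := Σ e, 𝒢.FundamentalGroup T ⧸ 𝒢.edgeSubgroup T e) (M := Multiplicative (ZMod 2)))
  have hcomm : ∀ e (a : 𝒢.edgeGroup e), i (δ e) * j (𝒢.vertexHom T _ (𝒢.srcHom e a)) =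
      j (𝒢.vertexHom T _ (𝒢.srcHom e a)) * i (δ e) := by
    intro e a
    have := SemidirectProduct.inl_aut (φ := mulAutArrow (G := 𝒢.FundamentalGroup T)
      (A := Σ e, 𝒢.FundamentalGroup T ⧸ 𝒢.edgeSubgroup T e) (M := Multiplicative (ZMod 2)))
      (𝒢.vertexHom T _ (𝒢.srcHom e a)) (δ e)
    rw [hδ, map_inv] at this
    exact eq_mul_inv_iff_mul_eq.1 this
  obtain ⟨Φ, hΦv, hΦl⟩ := 𝒢.exists_hom T
    (fun v => (MulAut.conj (i (p v))).toMonoidHom.comp (j.comp (𝒢.vertexHom T v)))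
    (fun e => i (p (𝒢.src e)) * i (δ e) * j (𝒢.letter T e) * (i (p (𝒢.tgt e)))⁻¹)
    (by
      intro e a
      have hj : j (𝒢.letter T e) * j (𝒢.vertexHom T _ (𝒢.tgtHom e a)) * (j (𝒢.letter T e))⁻¹ =
          j (𝒢.vertexHom T _ (𝒢.srcHom e a)) := by
        rw [← map_inv, ← map_mul, ← map_mul, letter_mul_vertexHom]
      change _ * (i (p (𝒢.tgt e)) * j (𝒢.vertexHom T _ (𝒢.tgtHom e a)) * (i (p (𝒢.tgt e)))⁻¹) * _ =
        i (p (𝒢.src e)) * j (𝒢.vertexHom T _ (𝒢.srcHom e a)) * (i (p (𝒢.src e)))⁻¹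
      have h2 : i (δ e) * j (𝒢.vertexHom T _ (𝒢.srcHom e a)) * (i (δ e))⁻¹ =
          j (𝒢.vertexHom T _ (𝒢.srcHom e a)) := by
        rw [hcomm, mul_inv_cancel_right]
      rw [← h2, ← hj]
      group)
    (by
      intro e he
      have := hp ⟨e, he⟩
      rw [this, 𝒢.letter_eq_one T he, map_one, mul_one, map_mul, mul_inv_cancel])
  refine ⟨{
    src_le := by rintro e _ ⟨a, rfl⟩; exact ⟨_, rfl⟩
    tgt_mem := ?_
    Φ := Φ
    Φ_right := ?_
    pot := p
    Φ_vertex := ?_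
    Φ_letter := ?_
    connected := 𝒢.bassSerre_connected T hT }⟩
  · rintro e _ ⟨a, rfl⟩
    refine ⟨𝒢.tgtHom e a, ?_⟩
    rw [MonoidHom.comp_apply, ← letter_mul_vertexHom]
    group
  · have : SemidirectProduct.rightHom.comp Φ = MonoidHom.id _ := by
      refine 𝒢.hom_ext T (fun v g => ?_) (fun e => ?_)
      · rw [MonoidHom.comp_apply, hΦv]
        simp [i, j]
      · rw [MonoidHom.comp_apply, hΦl]
        simp [i, j]
    exact fun g => DFunLike.congr_fun this g
  · rintro v _ ⟨g, rfl⟩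
    rw [hΦv]
    change i (p v) * j (𝒢.vertexHom T v g) * (i (p v))⁻¹ * i (p v) = _
    rw [inv_mul_cancel_right]
  · intro e
    refine ⟨δ e, ?_, fun ε hε => Pi.mulSingle_eq_of_ne hε _, ?_⟩
    · change δ e (ε₀ e) ≠ 1
      simp only [δ]
      rw [Pi.mulSingle_eq_same]
      decide
    · rw [hΦl]
      change i (p (𝒢.src e)) * i (δ e) * j (𝒢.letter T e) * (i (p (𝒢.tgt e)))⁻¹ *
        i (p (𝒢.tgt e)) = _
      rw [inv_mul_cancel_right]

/-- Injective homomorphisms from a group `A` into groups `B` turn the free `B`-sets `B × S`, with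
`S` infinite and not smaller than `B`, into isomorphic `A`-sets. -/
theorem exists_equiv_prod {A B : Type u} [Group A] [Group B] (i : A →* B)
    (hi : Function.Injective i) (S : Type u) [Infinite S] (hS : Cardinal.mk B ≤ Cardinal.mk S) :
    ∃ η : A × S ≃ B × S, ∀ a a' s, η (a * a', s) = (i a * (η (a', s)).1, (η (a', s)).2) := by
  let Q := Quotient (QuotientGroup.rightRel i.range)
  have hQS : Nonempty (S ≃ Q × S) := by
    rw [← Cardinal.eq, Cardinal.mk_prod, Cardinal.lift_id, Cardinal.lift_id,
      Cardinal.mul_eq_right (Cardinal.aleph0_le_mk S)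
        ((Cardinal.mk_le_of_surjective Quotient.mk_surjective).trans hS)]
    exact Cardinal.mk_ne_zero_iff.2 ⟨Quotient.mk _ 1⟩
  obtain ⟨χ⟩ := hQS
  have hbij : Function.Bijective fun x : A × Q => i x.1 * x.2.out := by
    constructor
    · rintro ⟨a, q⟩ ⟨a', q'⟩ h
      have hq : q = q' := by
        rw [← q.out_eq, ← q'.out_eq]
        refine Quotient.sound ?_
        change QuotientGroup.rightRel i.range _ _
        rw [QuotientGroup.rightRel_apply]
        refine ⟨a'⁻¹ * a, ?_⟩
        simp only at h
        rw [map_mul, map_inv, inv_mul_eq_iff_eq_mul, ← mul_assoc]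
        exact eq_mul_inv_iff_mul_eq.2 h
      subst hq
      simp only [mul_left_inj] at h
      rw [hi h]
    · intro b
      obtain ⟨a, ha⟩ := QuotientGroup.rightRel_apply.1 (Quotient.exact
        (Quotient.out_eq (Quotient.mk (QuotientGroup.rightRel i.range) b)))
      exact ⟨(a, Quotient.mk (QuotientGroup.rightRel i.range) b), by simp [ha]⟩
  refine ⟨(Equiv.prodCongr (Equiv.refl A) χ).trans ((Equiv.prodAssoc A Q S).symm.trans
    (Equiv.prodCongr (Equiv.ofBijective _ hbij) (Equiv.refl S))), fun a a' s => ?_⟩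
  simp [mul_assoc]

/-- The vertex groups embed into the fundamental group. They act freely on a common set, in such a
way that the actions of each edge group through its two embeddings are conjugate by a permutation;
these permutations represent the stable letters. -/
theorem vertexHom_injective (hT : 𝒢.IsMaximalTree T) (v₀ : 𝒢.V) :
    Function.Injective (𝒢.vertexHom T v₀) := by
  classical
  let S := (Σ v, 𝒢.vertexGroup v) × ULift.{u} ℕ
  have : Nonempty (Σ v, 𝒢.vertexGroup v) := ⟨⟨v₀, 1⟩⟩
  have hS : ∀ v, Cardinal.mk (𝒢.vertexGroup v) ≤ Cardinal.mk S := fun v =>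
    Cardinal.mk_le_of_injective (f := fun g => ((⟨v, g⟩, ⟨0⟩) : S)) fun a b h =>
      sigma_mk_injective (Prod.mk.inj h).1
  have hθ : ∀ v, Nonempty (𝒢.vertexGroup v × S ≃ S) := by
    intro v
    rw [← Cardinal.eq, Cardinal.mk_prod, Cardinal.lift_id, Cardinal.lift_id,
      Cardinal.mul_eq_right (Cardinal.aleph0_le_mk S) (hS v)]
    exact Cardinal.mk_ne_zero_iff.2 ⟨1⟩
  let θ := fun v => (hθ v).some
  let ρ₀ : ∀ v, 𝒢.vertexGroup v →* Equiv.Perm (𝒢.vertexGroup v × S) := fun v =>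
    { toFun := fun g => Equiv.prodCongr (Equiv.mulLeft g) (Equiv.refl S)
      map_one' := Equiv.ext fun ⟨x, s⟩ => by simp
      map_mul' := fun g h => Equiv.ext fun ⟨x, s⟩ => by simp [mul_assoc] }
  let ρ : ∀ v, 𝒢.vertexGroup v →* Equiv.Perm S := fun v =>
    (θ v).permCongrHom.toMonoidHom.comp (ρ₀ v)
  have hρ : ∀ v g y, ρ v g (θ v y) = θ v (g * y.1, y.2) := by
    intro v g y
    simp [ρ, ρ₀, Equiv.permCongrHom]
    rfl
  have hb : ∀ e, ∃ b : Equiv.Perm S, ∀ a,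
      b * ρ _ (𝒢.tgtHom e a) * b⁻¹ = ρ _ (𝒢.srcHom e a) := by
    intro e
    obtain ⟨ηs, hηs⟩ := exists_equiv_prod (𝒢.srcHom e) (𝒢.srcHom_injective e) S (hS _)
    obtain ⟨ηt, hηt⟩ := exists_equiv_prod (𝒢.tgtHom e) (𝒢.tgtHom_injective e) S (hS _)
    refine ⟨(θ (𝒢.tgt e)).symm.trans (ηt.symm.trans (ηs.trans (θ (𝒢.src e)))), fun a => ?_⟩
    rw [mul_inv_eq_iff_eq_mul]
    ext1 x
    obtain ⟨⟨a', s⟩, rfl⟩ := (ηt.trans (θ (𝒢.tgt e))).surjective x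
    simp only [Equiv.Perm.mul_apply, Equiv.trans_apply, Equiv.symm_apply_apply, hρ, ← hηt, ← hηs]
  choose b hb using hb
  obtain ⟨f, hf⟩ := IsMultigraphTree.exists_potential hT (fun e => b e)
  obtain ⟨Φ, hΦ, -⟩ := 𝒢.exists_hom T
    (fun v => (MulAut.conj (f v)).toMonoidHom.comp (ρ v))
    (fun e => f (𝒢.src e) * b e * (f (𝒢.tgt e))⁻¹)
    (by
      intro e a
      change _ * (f (𝒢.tgt e) * ρ _ (𝒢.tgtHom e a) * (f (𝒢.tgt e))⁻¹) * _ =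
        f (𝒢.src e) * ρ _ (𝒢.srcHom e a) * (f (𝒢.src e))⁻¹
      rw [← hb]
      group)
    (by
      intro e he
      have := hf ⟨e, he⟩
      rw [this, mul_inv_cancel])
  rw [injective_iff_map_eq_one]
  intro g hg
  have h1 := hΦ v₀ g
  rw [hg, map_one] at h1
  have h2 : ρ v₀ g = 1 := by
    change 1 = f v₀ * ρ v₀ g * (f v₀)⁻¹ at h1
    rwa [eq_mul_inv_iff_mul_eq, one_mul, left_eq_mul] at h1
  obtain ⟨s⟩ : Nonempty S := inferInstance
  have h3 := hρ v₀ g (1, s)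
  rw [h2, Equiv.Perm.one_apply, (θ v₀).apply_eq_iff_eq, mul_one] at h3
  exact (Prod.mk.inj h3).1.symm

end GraphOfGroups

/-! ### Finite index from vertex and edge stabilizers -/

section FiniteIndex

theorem Subgroup.fg_map_of_fg {Γ Δ : Type*} [Group Γ] [Group Δ] {G : Subgroup Γ} (hG : G.FG)
    (f : Γ →* Δ) : (G.map f).FG := by
  rw [← Group.fg_iff_subgroup_fg] at hG ⊢
  exact Group.fg_of_surjective (f.subgroupMap_surjective G)

theorem Subgroup.finiteIndex_iff_exists_finite {Γ : Type*} [Group Γ] {H : Subgroup Γ} :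
    H.FiniteIndex ↔ ∃ R : Set Γ, R.Finite ∧ ∀ x, ∃ h ∈ H, ∃ r ∈ R, x = h * r := by
  constructor
  · intro h
    refine ⟨Set.range fun q : Γ ⧸ H => q.out⁻¹, Set.finite_range _, fun x => ?_⟩
    refine ⟨x * ((x⁻¹ : Γ) : Γ ⧸ H).out, ?_, _, ⟨((x⁻¹ : Γ) : Γ ⧸ H), rfl⟩, by group⟩
    have := QuotientGroup.eq.1 (QuotientGroup.out_eq' ((x⁻¹ : Γ) : Γ ⧸ H)).symm
    simpa using this
  · rintro ⟨R, hR, h⟩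
    have : Finite (Γ ⧸ H) := by
      have := hR.to_subtype
      refine Finite.of_surjective (fun r : R => ((r⁻¹ : Γ) : Γ ⧸ H)) ?_
      intro q
      induction q using QuotientGroup.induction_on with
      | H x =>
        obtain ⟨g, hg, r, hr, hx⟩ := h x⁻¹
        refine ⟨⟨r, hr⟩, QuotientGroup.eq.2 ?_⟩
        have : x = r⁻¹ * g⁻¹ := by rw [← inv_inv x, hx, mul_inv_rev]
        rw [this]
        simpa using hg
    exact Subgroup.finiteIndex_of_finite_quotient

theorem FiniteOrbitsOn.conj {Γ α : Type*} [Group Γ] [MulAction Γ α] {G : Subgroup Γ} {a : α}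
    (h : FiniteOrbitsOn G (MulAction.orbit Γ a)) (γ : Γ) :
    FiniteOrbitsOn (G.map (MulAut.conj γ).toMonoidHom) (MulAction.orbit Γ a) := by
  obtain ⟨Φ, hΦ, h⟩ := h
  refine ⟨(γ • ·) '' Φ, hΦ.image _, fun x hx => ?_⟩
  obtain ⟨g, hg, φ, hφ, hgφ⟩ := h (γ⁻¹ • x) (MulAction.mem_orbit_of_mem_orbit _ hx)
  refine ⟨_, ⟨g, hg, rfl⟩, _, ⟨φ, hφ, rfl⟩, ?_⟩
  simp [mul_smul, hgφ]

/-- A subgroup with finitely many orbits on the orbit of `e` has finite index if all its conjugates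
have finite index in a group containing the stabilizer of `e`. -/
theorem FiniteOrbitsOn.finiteIndex {Γ α : Type*} [Group Γ] [MulAction Γ α] {G : Subgroup Γ}
    {e : α} (hGe : FiniteOrbitsOn G (MulAction.orbit Γ e))
    (h : ∀ γ : Γ, ∃ R : Set Γ, R.Finite ∧ ∀ s ∈ MulAction.stabilizer Γ e,
      ∃ g ∈ G.map (MulAut.conj γ).toMonoidHom, ∃ r ∈ R, s = g * r) : G.FiniteIndex := by
  choose R hR h using h
  obtain ⟨Φ, hΦ, hGe⟩ := hGe
  have hf : ∀ ε : α, ∃ f : Γ, (∃ w : Γ, w • e = ε) → f • e = ε := by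
    intro ε
    by_cases h : ∃ w : Γ, w • e = ε
    · exact ⟨h.choose, fun _ => h.choose_spec⟩
    · exact ⟨1, fun h' => absurd h' h⟩
  choose f hf using hf
  rw [Subgroup.finiteIndex_iff_exists_finite]
  refine ⟨⋃ ε ∈ Φ, (f ε * ·) '' R (f ε)⁻¹, hΦ.biUnion fun ε _ => (hR _).image _, fun x => ?_⟩
  obtain ⟨g, hg, ε, hε, hgε⟩ := hGe (x • e) ⟨x, rfl⟩
  have hfε := hf ε ⟨g⁻¹ * x, by rw [mul_smul, ← hgε, inv_smul_smul]⟩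
  obtain ⟨_, ⟨g', hg', rfl⟩, r, hr, hs⟩ := h (f ε)⁻¹ ((f ε)⁻¹ * g⁻¹ * x) (by
    change _ • e = e
    rw [mul_smul, mul_smul, ← hgε, inv_smul_smul, inv_smul_eq_iff, hfε])
  refine ⟨g * g', G.mul_mem hg hg', _, Set.mem_biUnion hε ⟨r, hr, rfl⟩, ?_⟩
  have hs' : (f ε)⁻¹ * g⁻¹ * x = (f ε)⁻¹ * g' * f ε * r := by
    rw [hs]; simp
  have : x = g * (f ε) * ((f ε)⁻¹ * g⁻¹ * x) := by group
  rw [this, hs']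
  group

end FiniteIndex

namespace TreeAction

section Graph

variable {Γ X E : Type*} [Group Γ] [MulAction Γ X] [MulAction Γ E] (t : TreeAction Γ X E)

theorem isAcyclic_of_adj {G : SimpleGraph X}
    (hG : ∀ x y, G.Adj x y → ∃ e b, t.endpt e (!b) = x ∧ t.endpt e b = y) : G.IsAcyclic := by
  rw [SimpleGraph.isAcyclic_iff_forall_adj_isBridge]
  intro x y hxy
  rw [SimpleGraph.isBridge_iff]
  obtain ⟨e, b, rfl, rfl⟩ := hG x y hxy
  rintro ⟨p⟩
  have key : ∀ {u w : X} (p : (G.deleteEdges {s(t.endpt e (!b), t.endpt e b)}).Walk u w),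
      u ∉ t.side e b → w ∉ t.side e b := by
    intro u w p
    induction p with
    | nil => exact id
    | cons h p ih =>
      intro hu
      refine ih fun hv => ?_
      rw [SimpleGraph.deleteEdges_adj] at h
      obtain ⟨e', b', rfl, rfl⟩ := hG _ _ h.1
      by_cases hee : e' = e
      · subst hee
        refine h.2 ?_
        by_cases hb : b' = b
        · subst hb; rfl
        · have : b' = !b := by cases b <;> cases b' <;> simp_all
          subst this
          exact absurd (t.endpt_mem e' b) (by simpa using hu)
      · exact hu ((t.endpt_mem_side_iff hee _ _ _).1 hv)
  exact key p (t.endpt_not_notMem e b) (t.endpt_mem e b)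

theorem ncard_sep_le_length {G : SimpleGraph X}
    (hG : ∀ x y, G.Adj x y → ∃ e b, t.endpt e (!b) = x ∧ t.endpt e b = y) {x y : X}
    (p : G.Walk x y) : (t.sep x y).ncard ≤ p.length := by
  induction p with
  | nil => simp [sep_self]
  | @cons u v w h p ih =>
    obtain ⟨e, b, rfl, rfl⟩ := hG _ _ h
    have h1 := Set.ncard_le_ncard (t.sep_subset (t.endpt e (!b)) (t.endpt e b) w)
      ((t.sep_finite _ _).union (t.sep_finite _ _))
    have h2 := Set.ncard_union_le (t.sep (t.endpt e (!b)) (t.endpt e b)) (t.sep (t.endpt e b) w)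
    have h3 := Set.ncard_le_ncard (t.sep_endpt_subset e (!b) b)
    rw [Set.ncard_singleton] at h3
    rw [SimpleGraph.Walk.length_cons]
    omega

/-- Acylindricity in terms of paths implies acylindricity in terms of separating edges. -/
theorem acylindrical_of_walks {G : SimpleGraph X}
    (hG : ∀ x y, G.Adj x y ↔ ∃ e b, t.endpt e (!b) = x ∧ t.endpt e b = y) {k : ℕ}
    (h : ∀ (x y : X) (p : G.Walk x y), p.IsPath → k < p.length →
      ∀ g : Γ, (∀ z ∈ p.support, g • z = z) → g = 1) : t.Acylindrical k := by
  classical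
  intro x y g hk hx hy
  have hreach : G.Reachable x y := by
    refine t.induction_endpt (fun y => G.Reachable x y) (fun e b he => ?_)
      (SimpleGraph.Reachable.refl x) y
    refine he.trans (SimpleGraph.Adj.reachable ((hG _ _).2 ⟨e, !b, by rw [Bool.not_not], rfl⟩))
  obtain ⟨p, hp⟩ : ∃ p : G.Walk x y, p.IsPath :=
    ⟨hreach.some.bypass, SimpleGraph.Walk.bypass_isPath _⟩
  have hlen := t.ncard_sep_le_length (fun x y => (hG x y).1) p
  refine h x y p hp (by omega) g ?_
  let f : G →g G := ⟨fun x => g • x, fun {a b} hab => by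
    obtain ⟨e, c, rfl, rfl⟩ := (hG _ _).1 hab
    exact (hG _ _).2 ⟨g • e, c, t.endpt_smul _ _ _, t.endpt_smul _ _ _⟩⟩
  have hpf : ((p.map f).copy hx hy).IsPath := by
    rw [SimpleGraph.Walk.isPath_copy]
    exact hp.map (MulAction.injective g)
  have hac := t.isAcyclic_of_adj (fun x y => (hG x y).1)
  have heq : (p.map f).copy hx hy = p :=
    congrArg Subtype.val ((hac.subsingleton_path x y).elim ⟨_, hpf⟩ ⟨p, hp⟩)
  have hsupp := congrArg SimpleGraph.Walk.support heq
  rw [SimpleGraph.Walk.support_copy, SimpleGraph.Walk.support_map] at hsupp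
  intro z hz
  exact List.map_inj_left.1 (hsupp.trans (List.map_id _).symm) z hz

end Graph

section FiniteIndex

variable {Γ X E : Type*} [Group Γ] [MulAction Γ X] [MulAction Γ E] (t : TreeAction Γ X E)

/-- If `G` has finitely many orbits on the orbit of an edge `e` at `v`, its intersection with the
stabilizer `V` of `v` is finitely generated and has finitely many double cosets with the cyclic
stabilizer of `e` in `V`. Hence it is wide in `V`; if this implies finite index, then `V` is covered
by finitely many right cosets of `G`. -/
theorem exists_finite_of_vertex {G : Subgroup Γ} (hG : G.FG) {e : E} {b : Bool} {v : X}
    (hev : t.endpt e b = v) (hGe : FiniteOrbitsOn G (MulAction.orbit Γ e))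
    (hcyc : ∀ e : E, IsCyclic (MulAction.stabilizer Γ e)) {V : Type*} [Group V] (φ : V →* Γ)
    (hφ : Function.Injective φ) (hφv : φ.range = MulAction.stabilizer Γ v)
    (hV : ∀ K : Subgroup V, K.FG → K.IsWide → K.FiniteIndex) :
    ∃ R : Set Γ, R.Finite ∧ ∀ s ∈ MulAction.stabilizer Γ v, ∃ g ∈ G, ∃ r ∈ R, s = g * r := by
  have hmem : ∀ w, φ w • v = v := fun w => by
    have : φ w ∈ MulAction.stabilizer Γ v := hφv ▸ ⟨w, rfl⟩
    exact this
  have hfg : (G ⊓ MulAction.stabilizer Γ v).FG := by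
    refine t.fg_inf_stabilizer hG v fun e => ?_
    have := hcyc e
    have h1 : IsCyclic (G ⊓ MulAction.stabilizer Γ v ⊓ MulAction.stabilizer Γ e : Subgroup Γ) :=
      isCyclic_of_injective (Subgroup.inclusion inf_le_right) (Subgroup.inclusion_injective _)
    obtain ⟨g, hg⟩ := h1.exists_generator
    rw [← Group.fg_iff_subgroup_fg]
    exact ⟨⟨{g}, by
      rw [Finset.coe_singleton, ← Subgroup.zpowers_eq_closure, eq_top_iff]
      exact fun x _ => hg x⟩⟩
  have hK : (G.comap φ).FG := by
    have h1 : (G.comap φ).map φ = G ⊓ MulAction.stabilizer Γ v := by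
      rw [Subgroup.map_comap_eq, hφv, inf_comm]
    rw [← h1, ← Group.fg_iff_subgroup_fg] at hfg
    rw [← Group.fg_iff_subgroup_fg]
    exact Group.fg_of_surjective (f := ((G.comap φ).equivMapOfInjective φ hφ).symm.toMonoidHom)
      (MulEquiv.surjective _)
  have hw : (G.comap φ).IsWide := by
    right
    obtain ⟨⟨c₀, hc₀⟩, hgen⟩ := (hcyc e).exists_generator
    have hstab : ∀ s, s • e = e → ∃ j : ℤ, s = c₀ ^ j := by
      intro s hs
      obtain ⟨j, hj⟩ := hgen ⟨s, hs⟩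
      exact ⟨j, (congrArg Subtype.val hj).symm⟩
    obtain ⟨c, hc⟩ : c₀ ∈ φ.range := by
      rw [hφv]
      change c₀ • v = v
      rw [← hev, ← t.endpt_smul, show c₀ • e = e from hc₀]
    have hA : FiniteOrbitsOn (G ⊓ MulAction.stabilizer Γ v) (Set.range fun w : V => φ w • e) := by
      refine t.finiteOrbitsOn_stabilizer b ?_ (hGe.mono ?_)
      · rintro _ ⟨w, rfl⟩
        rw [t.endpt_smul, hev, hmem]
      · rintro _ ⟨w, rfl⟩
        exact ⟨φ w, rfl⟩
    obtain ⟨Φ, hΦ, hA⟩ := hA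
    have hf : ∀ ε : E, ∃ f : V, (∃ w : V, φ w • e = ε) → φ f • e = ε := by
      intro ε
      by_cases h : ∃ w : V, φ w • e = ε
      · exact ⟨h.choose, fun _ => h.choose_spec⟩
      · exact ⟨1, fun h' => absurd h' h⟩
    choose f hf using hf
    refine ⟨c, f '' Φ, hΦ.image f, fun w => ?_⟩
    obtain ⟨g, ⟨hg, hgv⟩, ε, hε, hgε⟩ := hA _ ⟨w, rfl⟩
    rw [SetLike.mem_coe, ← hφv] at hgv
    obtain ⟨k, rfl⟩ := hgv
    have hfε := hf ε ⟨k⁻¹ * w, by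
      rw [map_mul, map_inv, mul_smul, inv_smul_eq_iff]; exact hgε.symm⟩
    obtain ⟨j, hj⟩ := hstab (φ ((f ε)⁻¹ * k⁻¹ * w)) (by
      rw [map_mul, map_mul, map_inv, map_inv, mul_smul, mul_smul, inv_smul_eq_iff, inv_smul_eq_iff,
        hfε, hgε])
    refine ⟨k, hg, _, ⟨ε, hε, rfl⟩, j, ?_⟩
    rw [← hc, ← map_zpow] at hj
    rw [← hφ hj]
    group
  obtain ⟨R, hR, h⟩ := Subgroup.finiteIndex_iff_exists_finite.1 (hV _ hK hw)
  refine ⟨φ '' R, hR.image φ, fun s hs => ?_⟩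
  rw [← hφv] at hs
  obtain ⟨w, rfl⟩ := hs
  obtain ⟨k, hk, r, hr, rfl⟩ := h w
  exact ⟨φ k, hk, φ r, ⟨r, hr, rfl⟩, map_mul _ _ _⟩

/-- In a group acting on a tree so that the stabilizer of some vertex fixes no edge and is proper,
not all elements commute. -/
theorem exists_not_commute (t : TreeAction Γ X E) {v : X}
    (hedge : ∀ e : E, ∃ a : Γ, a • v = v ∧ a • e ≠ e)
    (hne : ∃ γ : Γ, γ • v ≠ v) : ∃ x y : Γ, x * y ≠ y * x := by
  obtain ⟨γ, hγ⟩ := hne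
  obtain ⟨e, b, he, hb⟩ := t.exists_endpt_eq_of_ne hγ.symm
  obtain ⟨a, hav, hae⟩ := hedge e
  refine ⟨a, γ, fun h => ?_⟩
  have hd := (smul_eq_or_disjoint hav (b := b)
    (by rw [← he]; exact t.endpt_not_notMem _ _)).resolve_left hae
  refine Set.disjoint_left.1 hd ((t.smul_mem_side a).2 hb) ?_
  rwa [← mul_smul, h, mul_smul, hav]

end FiniteIndex

end TreeAction

section Transport

theorem Subgroup.IsWide.map_equiv {Γ Δ : Type*} [Group Γ] [Group Δ] (f : Γ ≃* Δ) {G : Subgroup Γ}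
    (h : G.IsWide) : (G.map f.toMonoidHom).IsWide := by
  rcases h with ⟨N, hN, hN1, hNG⟩ | ⟨c, F, hF, h⟩
  · exact .inl ⟨N.map f.toMonoidHom, hN.map _ f.surjective,
      fun h0 => hN1 ((Subgroup.map_eq_bot_iff_of_injective _ f.injective).1 h0),
      Subgroup.map_mono hNG⟩
  · refine .inr ⟨f c, f '' F, hF.image f, fun γ => ?_⟩
    obtain ⟨g, hg, x, hx, j, hγ⟩ := h (f.symm γ)
    refine ⟨f g, ⟨g, hg, rfl⟩, f x, ⟨x, hx, rfl⟩, j, ?_⟩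
    rw [← map_zpow, ← map_mul, ← map_mul, ← hγ, f.apply_symm_apply]

/-- Every finitely generated wide subgroup has finite index. -/
def WideImpliesFiniteIndex (Γ : Type*) [Group Γ] : Prop :=
  ∀ G : Subgroup Γ, G.FG → G.IsWide → G.FiniteIndex

theorem WideImpliesFiniteIndex.of_equiv {Γ Δ : Type*} [Group Γ] [Group Δ] (f : Γ ≃* Δ)
    (h : WideImpliesFiniteIndex Δ) : WideImpliesFiniteIndex Γ := by
  intro G hG hw
  have := h _ (Subgroup.fg_map_of_fg hG f.toMonoidHom) (hw.map_equiv f)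
  constructor
  have h1 := this.index_ne_zero
  have h2 : (G.map f.toMonoidHom).index = G.index := Subgroup.index_map_equiv G f
  rwa [h2] at h1

end Transport

/-! ### Free products and the induction on the level -/

theorem stabilizer_sigma_mk_one {π V : Type*} [Group π] (A : V → Subgroup π) (v : V) :
    MulAction.stabilizer π (⟨v, ((1 : π) : π ⧸ A v)⟩ : Σ v, π ⧸ A v) = A v := by
  ext g
  constructor
  · intro h
    have h1 : ((g * 1 : π) : π ⧸ A v) = ((1 : π) : π ⧸ A v) :=
      sigma_mk_injective (β := fun v => π ⧸ A v) h
    simpa using QuotientGroup.eq.1 h1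
  · intro h
    have h1 : ((g * 1 : π) : π ⧸ A v) = ((1 : π) : π ⧸ A v) := QuotientGroup.eq.2 (by simpa using h)
    exact congrArg (Sigma.mk v) h1

namespace GraphOfGroups

variable (𝒢 : GraphOfGroups.{u}) (T : Set 𝒢.E)

theorem stabilizer_base (v : 𝒢.V) :
    MulAction.stabilizer (𝒢.FundamentalGroup T)
      (⟨v, ((1 : 𝒢.FundamentalGroup T) : 𝒢.FundamentalGroup T ⧸ _)⟩ : 𝒢.BassSerreVertex T) =
      (𝒢.vertexHom T v).range :=
  stabilizer_sigma_mk_one (fun v => (𝒢.vertexHom T v).range) v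

theorem exists_stabilizer_edge (ε : Σ e, 𝒢.FundamentalGroup T ⧸ 𝒢.edgeSubgroup T e) :
    ∃ g, MulAction.stabilizer (𝒢.FundamentalGroup T) ε =
      (𝒢.edgeSubgroup T ε.1).map (MulAut.conj g).toMonoidHom := by
  obtain ⟨e, q⟩ := ε
  induction q using QuotientGroup.induction_on with
  | H g =>
    refine ⟨g, ?_⟩
    have h1 : (⟨e, (g : 𝒢.FundamentalGroup T ⧸ 𝒢.edgeSubgroup T e)⟩ :
        Σ e, 𝒢.FundamentalGroup T ⧸ 𝒢.edgeSubgroup T e) =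
        g • ⟨e, ((1 : 𝒢.FundamentalGroup T) : 𝒢.FundamentalGroup T ⧸ _)⟩ := by
      change _ = (⟨e, ((g * 1 : 𝒢.FundamentalGroup T) : 𝒢.FundamentalGroup T ⧸ _)⟩ :
        Σ e, 𝒢.FundamentalGroup T ⧸ 𝒢.edgeSubgroup T e)
      rw [mul_one]
    rw [h1, MulAction.stabilizer_smul_eq_stabilizer_map_conj]
    rw [stabilizer_sigma_mk_one]
    rfl

variable {T} in
theorem bassSerreTree_adj_iff (c : CosetTreeData 𝒢.src 𝒢.tgt (fun v => (𝒢.vertexHom T v).range)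
    (𝒢.edgeSubgroup T) (𝒢.letter T)) (x y : 𝒢.BassSerreVertex T) :
    (𝒢.bassSerreTree T).Adj x y ↔
      ∃ e b, c.treeAction.endpt e (!b) = x ∧ c.treeAction.endpt e b = y := by
  rw [bassSerreTree, SimpleGraph.fromRel_adj]
  constructor
  · rintro ⟨-, ⟨e, g, rfl, rfl⟩ | ⟨e, g, rfl, rfl⟩⟩
    · exact ⟨⟨e, (g : 𝒢.FundamentalGroup T ⧸ _)⟩, true, rfl, rfl⟩
    · exact ⟨⟨e, (g : 𝒢.FundamentalGroup T ⧸ _)⟩, false, rfl, rfl⟩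
  · rintro ⟨ε, b, rfl, rfl⟩
    refine ⟨fun h => c.treeAction.endpt_not_notMem ε b (h ▸ c.treeAction.endpt_mem ε b), ?_⟩
    obtain ⟨e, q⟩ := ε
    induction q using QuotientGroup.induction_on with
    | H g =>
      cases b
      · exact .inr ⟨e, g, rfl, rfl⟩
      · exact .inl ⟨e, g, rfl, rfl⟩

/-- The inductive step: the property passes from a non-cyclic vertex group to the fundamental group
of an acylindrical graph of groups with cyclic edge groups. -/
theorem wideImpliesFiniteIndex (hT : 𝒢.IsMaximalTree T) (hac : 𝒢.IsAcylindrical T)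
    (hcyc : ∀ e, IsCyclic (𝒢.edgeGroup e)) {v : 𝒢.V} (hnc : ¬ IsCyclic (𝒢.vertexGroup v))
    (hV : WideImpliesFiniteIndex (𝒢.vertexGroup v)) :
    WideImpliesFiniteIndex (𝒢.FundamentalGroup T) := by
  obtain ⟨c⟩ := 𝒢.nonempty_cosetTreeData T hT
  obtain ⟨k, hk⟩ := hac
  have hinj := 𝒢.vertexHom_injective T hT v
  have htk : c.treeAction.Acylindrical k :=
    c.treeAction.acylindrical_of_walks (𝒢.bassSerreTree_adj_iff c) hk
  set x : 𝒢.BassSerreVertex T :=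
    ⟨v, ((1 : 𝒢.FundamentalGroup T) : 𝒢.FundamentalGroup T ⧸ _)⟩ with hx
  have hstab := 𝒢.stabilizer_base T v
  rw [← hx] at hstab
  by_cases htop : ∀ γ : 𝒢.FundamentalGroup T, γ • x = x
  · have hsurj : Function.Surjective (𝒢.vertexHom T v) := by
      rw [← MonoidHom.range_eq_top, ← hstab, eq_top_iff]
      exact fun γ _ => htop γ
    exact hV.of_equiv (MulEquiv.ofBijective _ ⟨hinj, hsurj⟩).symm
  push Not at htop
  have hecyc : ∀ ε : Σ e, 𝒢.FundamentalGroup T ⧸ 𝒢.edgeSubgroup T e,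
      IsCyclic (MulAction.stabilizer (𝒢.FundamentalGroup T) ε) := by
    intro ε
    obtain ⟨g, hg⟩ := 𝒢.exists_stabilizer_edge T ε
    rw [hg]
    have := hcyc ε.1
    have h1 : IsCyclic (𝒢.edgeSubgroup T ε.1) :=
      isCyclic_of_surjective _ (MonoidHom.rangeRestrict_surjective _)
    exact isCyclic_of_surjective
      ((MulAut.conj g).toMonoidHom.subgroupMap (𝒢.edgeSubgroup T ε.1))
      (MonoidHom.subgroupMap_surjective (MulAut.conj g).toMonoidHom (𝒢.edgeSubgroup T ε.1))
  have hedge : ∀ ε : Σ e, 𝒢.FundamentalGroup T ⧸ 𝒢.edgeSubgroup T e,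
      ∃ a : 𝒢.FundamentalGroup T, a • x = x ∧ a • ε ≠ ε := by
    intro ε
    by_contra hcon
    push Not at hcon
    have := hecyc ε
    have hmem : ∀ g : 𝒢.vertexGroup v,
        𝒢.vertexHom T v g ∈ MulAction.stabilizer (𝒢.FundamentalGroup T) ε := fun g => by
      have : 𝒢.vertexHom T v g ∈ MulAction.stabilizer (𝒢.FundamentalGroup T) x :=
        hstab ▸ ⟨g, rfl⟩
      exact hcon _ this
    exact hnc (isCyclic_of_injective
      ((𝒢.vertexHom T v).codRestrict (MulAction.stabilizer (𝒢.FundamentalGroup T) ε) hmem)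
      fun a b hab => hinj (congrArg Subtype.val hab))
  obtain ⟨a, ha⟩ : ∃ a : Fin 3 → 𝒢.vertexGroup v, Function.Injective a := by
    obtain ⟨g, hg⟩ : ∃ g : 𝒢.vertexGroup v, g ≠ 1 := by
      by_contra h
      push Not at h
      exact hnc ⟨1, fun y => ⟨0, by simpa using (h y).symm⟩⟩
    obtain ⟨g', hg'⟩ : ∃ g' : 𝒢.vertexGroup v, g' ∉ Subgroup.zpowers g := by
      by_contra h
      push Not at h
      exact hnc ⟨g, h⟩
    have h1 : g' ≠ 1 := by rintro rfl; exact hg' (Subgroup.one_mem _)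
    have h2 : g' ≠ g := by rintro rfl; exact hg' (Subgroup.mem_zpowers _)
    refine ⟨![1, g, g'], ?_⟩
    intro i j hij
    fin_cases i <;> fin_cases j <;> simp_all
  intro G hG hw
  obtain ⟨ε, b, hεx, hGε⟩ := TreeAction.exists_edge_finiteOrbitsOn_of_isWide htk hG hw
    (a := fun i => 𝒢.vertexHom T v (a i)) (hinj.comp ha) (v := x) (fun i => by
      have : 𝒢.vertexHom T v (a i) ∈ MulAction.stabilizer (𝒢.FundamentalGroup T) x :=
        hstab ▸ ⟨_, rfl⟩
      exact this) hedge htop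
  refine hGε.finiteIndex fun γ => ?_
  obtain ⟨R, hR, h⟩ := c.treeAction.exists_finite_of_vertex
    (Subgroup.fg_map_of_fg hG (MulAut.conj γ).toMonoidHom) hεx (hGε.conj γ) hecyc
    (𝒢.vertexHom T v) hinj hstab.symm hV
  refine ⟨R, hR, fun s hs => h s ?_⟩
  rw [MulAction.mem_stabilizer_iff] at hs ⊢
  rw [← hεx, ← TreeAction.endpt_smul, hs]

/-- If all edge groups are trivial, the action on the Bass–Serre tree has trivial edge stabilizers,
so finiteness of the number of orbits on an orbit of edges already is finiteness of the index. -/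
theorem wideImpliesFiniteIndex_of_subsingleton (hT : 𝒢.IsMaximalTree T)
    (hE : ∀ e, Subsingleton (𝒢.edgeGroup e)) {v : 𝒢.V} (a : Fin 3 → 𝒢.vertexGroup v)
    (ha : Function.Injective a) {γ : 𝒢.FundamentalGroup T} (hγ : γ ∉ (𝒢.vertexHom T v).range) :
    WideImpliesFiniteIndex (𝒢.FundamentalGroup T) ∧ ¬ IsCyclic (𝒢.FundamentalGroup T) := by
  obtain ⟨c⟩ := 𝒢.nonempty_cosetTreeData T hT
  have hinj := 𝒢.vertexHom_injective T hT v
  set x : 𝒢.BassSerreVertex T :=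
    ⟨v, ((1 : 𝒢.FundamentalGroup T) : 𝒢.FundamentalGroup T ⧸ _)⟩ with hx
  have hstab := 𝒢.stabilizer_base T v
  rw [← hx] at hstab
  have hax : ∀ g, 𝒢.vertexHom T v g • x = x := fun g => by
    have : 𝒢.vertexHom T v g ∈ MulAction.stabilizer (𝒢.FundamentalGroup T) x := hstab ▸ ⟨g, rfl⟩
    exact this
  have htriv : ∀ (ε : Σ e, 𝒢.FundamentalGroup T ⧸ 𝒢.edgeSubgroup T e) (g : 𝒢.FundamentalGroup T),
      g • ε = ε → g = 1 := by
    intro ε g hg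
    obtain ⟨g', hg'⟩ := 𝒢.exists_stabilizer_edge T ε
    have h1 : g ∈ MulAction.stabilizer (𝒢.FundamentalGroup T) ε := hg
    rw [hg'] at h1
    obtain ⟨_, ⟨s, rfl⟩, rfl⟩ := h1
    have := hE ε.1
    rw [Subsingleton.elim s 1, map_one, map_one]
  have htk : c.treeAction.Acylindrical 0 := by
    intro y z g hk hy hz
    obtain ⟨ε, hε⟩ := (Set.ncard_pos (c.treeAction.sep_finite y z)).1 hk
    obtain ⟨b, h1, h2⟩ := c.treeAction.exists_side_of_mem_sep hε
    refine htriv ε g ((TreeAction.smul_eq_or_disjoint hy h1).resolve_right fun hd => ?_)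
    refine Set.disjoint_left.1 hd ?_ h2
    rw [← hz, TreeAction.smul_mem_side]
    exact h2
  have hedge : ∀ ε : Σ e, 𝒢.FundamentalGroup T ⧸ 𝒢.edgeSubgroup T e,
      ∃ a : 𝒢.FundamentalGroup T, a • x = x ∧ a • ε ≠ ε := by
    intro ε
    obtain ⟨i, hi⟩ : ∃ i, a i ≠ 1 := by
      by_contra h
      push Not at h
      exact absurd (ha ((h 0).trans (h 1).symm)) (by decide)
    refine ⟨𝒢.vertexHom T v (a i), hax _, fun h => hi (hinj ?_)⟩
    rw [htriv ε _ h, map_one]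
  have hne : ∃ γ : 𝒢.FundamentalGroup T, γ • x ≠ x := by
    refine ⟨γ, fun h => hγ ?_⟩
    rw [← hstab]
    exact h
  constructor
  · intro G hG hw
    obtain ⟨ε, b, -, hGε⟩ := TreeAction.exists_edge_finiteOrbitsOn_of_isWide htk hG hw
      (a := fun i => 𝒢.vertexHom T v (a i)) (hinj.comp ha) (v := x) (fun i => hax _) hedge hne
    refine hGε.finiteIndex fun γ => ⟨{1}, Set.finite_singleton _, fun s hs => ?_⟩
    exact ⟨1, Subgroup.one_mem _, 1, rfl, by rw [htriv ε s hs, mul_one]⟩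
  · intro hcyc
    obtain ⟨y, z, h⟩ := c.treeAction.exists_not_commute hedge hne
    obtain ⟨g, hg⟩ := hcyc.exists_generator
    obtain ⟨i, rfl⟩ := hg y
    obtain ⟨j, rfl⟩ := hg z
    exact h (zpow_mul_comm g i j)

/-- The multigraph may have several edges here, since they do not show in the underlying graph. -/
theorem isTree_segment {E : Type*} [Nonempty E] :
    (underlyingGraph (fun _ : E => (⟨true⟩ : ULift.{u} Bool)) fun _ => ⟨false⟩).IsTree := by
  set G := underlyingGraph (fun _ : E => (⟨true⟩ : ULift.{u} Bool)) fun _ => ⟨false⟩ with hG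
  have hadj : G.Adj ⟨true⟩ ⟨false⟩ := by
    rw [hG, underlyingGraph, SimpleGraph.fromRel_adj]
    exact ⟨by simp, .inl ⟨Classical.arbitrary E, rfl, rfl⟩⟩
  have : Nonempty (ULift.{u} Bool) := ⟨⟨true⟩⟩
  refine ⟨⟨?_⟩, ?_⟩
  · rintro ⟨_ | _⟩ ⟨_ | _⟩
    · rfl
    · exact hadj.symm.reachable
    · exact hadj.reachable
    · rfl
  · rw [SimpleGraph.isAcyclic_iff_forall_adj_isBridge]
    have key : ∀ x y, G.Adj x y → s(x, y) = s(⟨true⟩, ⟨false⟩) := by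
      rintro ⟨_ | _⟩ ⟨_ | _⟩ h
      · exact absurd rfl h.ne
      · exact Sym2.eq_swap
      · rfl
      · exact absurd rfl h.ne
    intro x y hxy
    rw [SimpleGraph.isBridge_iff]
    rintro ⟨p⟩
    cases p with
    | nil => exact hxy.ne rfl
    | cons h _ =>
      rw [SimpleGraph.deleteEdges_adj] at h
      exact h.2 ((key _ _ h.1).trans (key _ _ hxy).symm)

/-- The graph of groups with one edge, trivial edge group, and vertex groups `A` and `B`. -/
def freeProduct (A B : Type u) [Group A] [Group B] : GraphOfGroups.{u} where
  V := ULift.{u} Bool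
  E := PUnit
  src _ := ⟨true⟩
  tgt _ := ⟨false⟩
  connected := isTree_segment.connected
  vertexGroup v := match v with
    | ⟨true⟩ => A
    | ⟨false⟩ => B
  edgeGroup _ := PUnit
  instVertexGroup v := match v with
    | ⟨true⟩ => inferInstanceAs (Group A)
    | ⟨false⟩ => inferInstanceAs (Group B)
  instEdgeGroup _ := inferInstance
  srcHom _ := 1
  tgtHom _ := 1
  srcHom_injective _ := Function.injective_of_subsingleton _
  tgtHom_injective _ := Function.injective_of_subsingleton _

theorem freeProduct_isMaximalTree (A B : Type u) [Group A] [Group B] :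
    (freeProduct A B).IsMaximalTree Set.univ := by
  have : Nonempty (Set.univ : Set (freeProduct A B).E) := ⟨⟨PUnit.unit, trivial⟩⟩
  refine ⟨?_, ?_, isTree_segment⟩
  · rintro ⟨⟨⟩, _⟩ h
    have : (⟨true⟩ : ULift.{u} Bool) = ⟨false⟩ := h
    simp at this
  · rintro ⟨⟨⟩, _⟩ ⟨⟨⟩, _⟩ _
    rfl

/-- Homomorphisms on the two factors extend to the fundamental group of `freeProduct A B`. -/
theorem freeProduct_exists_hom {A B : Type u} [Group A] [Group B] {H : Type*} [Group H]
    (f : A →* H) (f' : B →* H) :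
    ∃ Φ : (freeProduct A B).FundamentalGroup Set.univ →* H,
      (∀ a : A, Φ ((freeProduct A B).vertexHom Set.univ ⟨true⟩ a) = f a) ∧
      (∀ b : B, Φ ((freeProduct A B).vertexHom Set.univ ⟨false⟩ b) = f' b) := by
  obtain ⟨Φ, hΦ, -⟩ := (freeProduct A B).exists_hom Set.univ (H := H)
    (fun v => match v with
      | ⟨true⟩ => f
      | ⟨false⟩ => f') (fun _ => 1)
    (by
      intro e a
      rw [one_mul, inv_one, mul_one]
      change f' 1 = f 1
      rw [map_one, map_one])
    (fun _ _ => rfl)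
  exact ⟨Φ, fun a => hΦ ⟨true⟩ a, fun b => hΦ ⟨false⟩ b⟩

theorem freeProduct_nonempty_mulEquiv (A B : Type u) [Group A] [Group B] :
    Nonempty ((freeProduct A B).FundamentalGroup Set.univ ≃* A ∗ B) := by
  obtain ⟨Φ, hA, hB⟩ := freeProduct_exists_hom (Monoid.Coprod.inl : A →* A ∗ B)
    (Monoid.Coprod.inr : B →* A ∗ B)
  let Ψ : A ∗ B →* (freeProduct A B).FundamentalGroup Set.univ :=
    Monoid.Coprod.lift ((freeProduct A B).vertexHom Set.univ ⟨true⟩)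
      ((freeProduct A B).vertexHom Set.univ ⟨false⟩)
  refine ⟨MonoidHom.toMulEquiv Φ Ψ ?_ ?_⟩
  · refine (freeProduct A B).hom_ext Set.univ ?_ ?_
    · rintro ⟨_ | _⟩ g
      · change Ψ (Φ _) = _
        rw [hB g]
        exact Monoid.Coprod.lift_apply_inr _ _ _
      · change Ψ (Φ _) = _
        rw [hA g]
        exact Monoid.Coprod.lift_apply_inl _ _ _
    · intro e
      rw [letter_eq_one _ _ (Set.mem_univ e), map_one, map_one]
  · refine Monoid.Coprod.hom_ext ?_ ?_
    · ext a
      change Φ (Ψ (Monoid.Coprod.inl a)) = _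
      have : Ψ (Monoid.Coprod.inl a) = (freeProduct A B).vertexHom Set.univ ⟨true⟩ a :=
        Monoid.Coprod.lift_apply_inl _ _ _
      rw [this, hA]
      rfl
    · ext b
      change Φ (Ψ (Monoid.Coprod.inr b)) = _
      have : Ψ (Monoid.Coprod.inr b) = (freeProduct A B).vertexHom Set.univ ⟨false⟩ b :=
        Monoid.Coprod.lift_apply_inr _ _ _
      rw [this, hB]
      rfl

end GraphOfGroups

section Induction

theorem exists_injective_fin_three {A : Type*} (h : 3 ≤ ENat.card A) :
    ∃ a : Fin 3 → A, Function.Injective a := by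
  rcases finite_or_infinite A with hA | hA
  · have := Fintype.ofFinite A
    rw [ENat.card_eq_coe_fintype_card] at h
    have h' : Fintype.card (Fin 3) ≤ Fintype.card A := by
      rw [Fintype.card_fin]; exact_mod_cast h
    obtain ⟨f⟩ := Function.Embedding.nonempty_of_card_le h'
    exact ⟨f, f.injective⟩
  · exact ⟨fun i => Infinite.natEmbedding A i,
      (Infinite.natEmbedding A).injective.comp Fin.val_injective⟩

theorem coprod_wideImpliesFiniteIndex {A B : Type u} [Group A] [Group B] [Nontrivial B]
    (hA : 3 ≤ ENat.card A) :
    WideImpliesFiniteIndex (A ∗ B) ∧ ¬ IsCyclic (A ∗ B) := by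
  obtain ⟨f⟩ := GraphOfGroups.freeProduct_nonempty_mulEquiv A B
  obtain ⟨a, ha⟩ := exists_injective_fin_three hA
  obtain ⟨b, hb⟩ := exists_ne (1 : B)
  obtain ⟨Φ, hΦA, hΦB⟩ := GraphOfGroups.freeProduct_exists_hom (1 : A →* B) (MonoidHom.id B)
  obtain ⟨h1, h2⟩ := (GraphOfGroups.freeProduct A B).wideImpliesFiniteIndex_of_subsingleton Set.univ
    (GraphOfGroups.freeProduct_isMaximalTree A B) (fun _ => inferInstanceAs (Subsingleton PUnit))
    (v := ⟨true⟩) a ha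
    (γ := (GraphOfGroups.freeProduct A B).vertexHom Set.univ ⟨false⟩ b) (by
      rintro ⟨x, hx⟩
      have := congrArg Φ hx
      rw [hΦA x, hΦB b] at this
      exact hb this.symm)
  exact ⟨h1.of_equiv f.symm, fun h => h2 (isCyclic_of_surjective f.symm f.symm.surjective)⟩

/-- Groups in the class are not cyclic, and their finitely generated wide subgroups have finite
index. -/
theorem ClassCLevel.wideImpliesFiniteIndex {n : ℕ} : ∀ {Γ : Type u} [Group Γ], ClassCLevel n Γ →
    WideImpliesFiniteIndex Γ ∧ ¬ IsCyclic Γ := by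
  induction n with
  | zero =>
    rintro Γ _ ⟨A, B, _, _, hA, hB, -, -, hcard, ⟨f⟩⟩
    obtain ⟨h1, h2⟩ : WideImpliesFiniteIndex (A ∗ B) ∧ ¬ IsCyclic (A ∗ B) := by
      rcases hcard with h | h
      · exact coprod_wideImpliesFiniteIndex h
      · obtain ⟨h1, h2⟩ := coprod_wideImpliesFiniteIndex (A := B) (B := A) h
        let f := MulEquiv.coprodComm A B
        exact ⟨h1.of_equiv f, fun h => h2 (isCyclic_of_surjective f f.surjective)⟩
    exact ⟨h1.of_equiv f, fun h => h2 (isCyclic_of_surjective f f.surjective)⟩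
  | succ n ih =>
    rintro Γ _ ⟨𝒢, T, -, -, hT, -, hcyc, hac, ⟨v, hv⟩, ⟨f⟩⟩
    obtain ⟨h1, h2⟩ := ih hv
    refine ⟨(𝒢.wideImpliesFiniteIndex T hT hac hcyc h2 h1).of_equiv f, fun h => h2 ?_⟩
    exact isCyclic_of_injective (f.symm.toMonoidHom.comp (𝒢.vertexHom T v))
      (f.symm.injective.comp (𝒢.vertexHom_injective T hT v))

end Induction

theorem mainTheorem6 {Γ : Type u} [Group Γ] (hΓ : InClassC Γ) (N G : Subgroup Γ)
    (hN : N.Normal) (hN_ne : N ≠ ⊥) (hNG : N ≤ G) (hG : G.FG) : G.FiniteIndex := by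
  obtain ⟨n, hn⟩ := hΓ
  exact hn.wideImpliesFiniteIndex.1 G hG (.inl ⟨N, hN, hN_ne, hNG⟩)
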